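/- **Model.** Let $L:[0,\infty)\to[0,\infty)$ be a measurable path gain with $0<L_0:=L(0)<\infty$, $L(r)\le L_0$, $\lim_{r\to0^+}L(r)=L_0$ and $0<\int_0^\infty rL(r)\,dr<\infty$. Assume that there are $r_0\ge 0$, $\zeta>0$, $\lambda_c\ge 0$ and a positive differentiable non-increasing function $\tilde L$ on $[r_0,\infty)$ with $\tilde L\le L$, $r\tilde L(r)\ge-\zeta\tilde L'(r)$, and $\int_{r_0}^\infty \frac{r}{\tilde L(r)^2}e^{-\pi\lambda_0r^2}dr<\infty$ for all $\lambda_0>\lambda_c$. Let $\sigma^2>0$, and let $N_t:[0,\infty)\to\mathbb N$ be non-decreasing with $N_t(0)=0$ and $N_t(\lambda)\to\infty$ as $\lambda\to\infty$. The base stations are the points $(x_n,t_n)$ of a Poisson process of unit intensity on $\mathbb R^2\times(0,\infty)$; the network of density $\lambda$ is $\Phi_\lambda=\{x_n : t_n\le\lambda\}$, a homogeneous Poisson process of intensity $\lambda$ on $\mathbb R^2$ (increasing $\lambda$ superposes independent Poisson processes). Let $(g_n)$ be i.i.d. unit-mean exponential variables and $(h_j)$ i.i.d. circularly symmetric complex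 Gaussian variables with mean zero and unit variance, with $(x_n,t_n)_n$, $(g_n)$, $(h_j)$ independent. With $\rho_\lambda$ the distance from the origin to the nearest point of $\Phi_\lambda$, put $$\mathrm{SINR}(\lambda)=\frac{L(\rho_\lambda)\sum_{j=1}^{N_t(\lambda)}|h_j|^2}{\sum_{n:\,t_n\le\lambda,\ |x_n|>\rho_\lambda}L(|x_n|)g_n+\sigma^2},\qquad \mathcal E(\lambda)=\lambda\log_2(1+\mathrm{SINR}(\lambda)).$$ **Theorem 2.** In this MISO model, $\mathcal E(\lambda)$ is integrable for all sufficiently large $\lambda$, and as $\lambda\to\infty$ the conditional area spectral efficiency $\mathcal E(\lambda)$ (almost surely) and the mean area spectral efficiency $\mathbb E[\mathcal E(\lambda)]$ are both of exact order $\lambda\log\left(1+\frac{N_t(\lambda)}{\lambda}\right)$, that is, $\Theta\left(\lambda\log\left(1+\frac{N_t(\lambda)}{\lambda}\right)\right)$. More specifically, say that growth is at scale $s(\lambda)$ if $\mathcal E(\lambda)\to\infty$ almost surely, $\mathbb E[\mathcal E(\lambda)]\to\infty$, and there is a deterministic constant $C\in(0,\infty)$ such that $\mathcal E(\lambda)/s(\lambda)\to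 C$ almost surely and $\mathbb E[\mathcal E(\lambda)]/s(\lambda)\to C$. Then: - if $\lim_{\lambda\to\infty}\lambda/N_t(\lambda)=\infty$, growth is at scale $N_t(\lambda)$; - if $\lim_{\lambda\to\infty}\lambda/N_t(\lambda)=c\in(0,\infty)$, growth is at scale $\lambda$; - if $\lim_{\lambda\to\infty}\lambda/N_t(\lambda)=0$, growth is at scale $\lambda\log\left(1+\frac{N_t(\lambda)}{\lambda}\right)$. -/

import Mathlib

open MeasureTheory ProbabilityTheory Filter Topology Asymptotics Set
open scoped ENNReal NNReal

noncomputable section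

/-- A physically feasible path loss model; `L r` is the large-scale channel gain at distance
`r ≥ 0` (only the values on `[0, ∞)` matter). The gain at short distances tends to
`L₀ = L 0`. -/
structure PhysicallyFeasible (L : ℝ → ℝ) : Prop where
  measurable : Measurable L
  nonneg : ∀ r, 0 ≤ r → 0 ≤ L r
  zero_pos : 0 < L 0
  continuous_zero : ContinuousWithinAt L (Ici 0) 0
  le_zero : ∀ r, 0 ≤ r → L r ≤ L 0
  integrable : IntegrableOn (fun r => r * L r) (Ioi 0)
  integral_pos : 0 < ∫ r in Ioi (0 : ℝ), r * L r

/-- The tractability assumption: from some distance `r₀` on, `L` is bounded below by a positive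
differentiable decreasing function `Lt` with `r Lt(r) / (-Lt'(r)) ≥ ζ > 0` (written without the
division, so that `Lt'(r) = 0` is allowed) and with
`∫_{r₀}^∞ r / Lt(r)² exp(-π l r²) dr < ∞` for all `l` above some critical value `lc`. -/
def TractableLowerBound (L : ℝ → ℝ) : Prop :=
  ∃ r₀ : ℝ, 0 ≤ r₀ ∧ ∃ ζ : ℝ, 0 < ζ ∧ ∃ Lt : ℝ → ℝ,
    (∀ r ∈ Ici r₀, 0 < Lt r) ∧ DifferentiableOn ℝ Lt (Ici r₀) ∧ AntitoneOn Lt (Ici r₀) ∧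
    (∀ r ∈ Ici r₀, Lt r ≤ L r) ∧
    (∀ r ∈ Ici r₀, ζ * -derivWithin Lt (Ici r₀) r ≤ r * Lt r) ∧
    ∃ lc : ℝ, 0 ≤ lc ∧ ∀ l : ℝ, lc < l →
      IntegrableOn (fun r => r / Lt r ^ 2 * Real.exp (-Real.pi * l * r ^ 2)) (Ioi r₀)

/-- The number of points of the configuration `X 0, X 1, …` in `A`, as an extended
nonnegative real. -/
def pointCount {Ω E : Type*} (X : ℕ → Ω → E) (A : Set E) (ω : Ω) : ℝ≥0∞ :=
  ∑' n, A.indicator (fun _ => (1 : ℝ≥0∞)) (X n ω)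

/-- `X 0, X 1, …` is a (measurable) enumeration of the points of a Poisson point process with
intensity measure `ν`: counts in sets of finite `ν`-measure are Poisson distributed and counts in
pairwise disjoint sets are independent. -/
structure IsPoissonProcess {Ω E : Type*} [MeasurableSpace Ω] [MeasurableSpace E]
    (X : ℕ → Ω → E) (ν : Measure E) (P : Measure Ω) : Prop where
  measurable : ∀ n, Measurable (X n)
  law : ∀ A, MeasurableSet A → ν A ≠ ∞ →
    HasLaw (pointCount X A) ((poissonMeasure (ν A).toNNReal).map (fun k : ℕ => (k : ℝ≥0∞))) P
  indep : ∀ (m : ℕ) (A : Fin m → Set E), (∀ i, MeasurableSet (A i)) →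
    Pairwise (fun i j => Disjoint (A i) (A j)) → iIndepFun (fun i => pointCount X (A i)) P

/-- The circularly symmetric complex Gaussian law with mean zero and unit variance. -/
def stdComplexGaussian : Measure ℂ :=
  ((gaussianReal 0 (1 / 2)).prod (gaussianReal 0 (1 / 2))).map
    Complex.measurableEquivRealProd.symm

/-- The probabilistic model of the MISO downlink, for all base station densities at once.
Base station number `n` is `X n = (position, activation density)`: in the network of density `l`
exactly the stations with activation density at most `l` are present. The points `X n` form a
Poisson process of unit intensity on `ℝ² × (0, ∞)`, so that the stations of the network of density
`l` form a homogeneous Poisson process of intensity `l`, and raising the density superposes an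
independent Poisson process. `g n` is the fading gain of station `n` as an interferer, and `h j`
is the channel between the `j`-th antenna of the serving station and the user. -/
structure IsMISOModel {Ω : Type*} [MeasurableSpace Ω]
    (X : ℕ → Ω → EuclideanSpace ℝ (Fin 2) × ℝ) (g : ℕ → Ω → ℝ) (h : ℕ → Ω → ℂ)
    (P : Measure Ω) : Prop where
  poisson : IsPoissonProcess X (volume.prod (volume.restrict (Ioi (0 : ℝ)))) P
  fading_law : ∀ n, HasLaw (g n) (expMeasure 1) P
  fading_indep : iIndepFun g P
  channel_law : ∀ j, HasLaw (h j) stdComplexGaussian P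
  channel_indep : iIndepFun h P
  indep_locations : IndepFun (fun ω n => X n ω) (fun ω => (fun n => g n ω, fun j => h j ω)) P
  indep_channel : IndepFun (fun ω n => g n ω) (fun ω j => h j ω) P

section Performance

variable {Ω : Type*} (L : ℝ → ℝ) (noise : ℝ) (N : ℝ → ℕ)
  (X : ℕ → Ω → EuclideanSpace ℝ (Fin 2) × ℝ) (g : ℕ → Ω → ℝ) (h : ℕ → Ω → ℂ)

/-- Distance from the user at the origin to the closest station of the network of density `l`. -/
def servingDistance (l : ℝ) (ω : Ω) : ℝ :=
  sInf {r : ℝ | ∃ n, (X n ω).2 ≤ l ∧ r = ‖(X n ω).1‖}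

/-- Gain of maximum ratio transmission with `N l` antennas: the squared Euclidean norm of the
channel vector, which is Gamma distributed with shape `N l` and unit rate. -/
def servingGain (l : ℝ) (ω : Ω) : ℝ :=
  ∑ j ∈ Finset.range (N l), ‖h j ω‖ ^ 2

open Classical in
/-- Total power received from the stations farther away than the serving one. -/
def interference (l : ℝ) (ω : Ω) : ℝ≥0∞ :=
  ∑' n, if (X n ω).2 ≤ l ∧ servingDistance X l ω < ‖(X n ω).1‖ then
    ENNReal.ofReal (L ‖(X n ω).1‖ * g n ω) else 0

/-- The conditional SINR at density `l`; `noise` is the noise variance. (It is `0` on the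
null event that the interference is infinite.) -/
def SINR (l : ℝ) (ω : Ω) : ℝ :=
  (ENNReal.ofReal (L (servingDistance X l ω) * servingGain N h l ω) /
    (interference L X g l ω + ENNReal.ofReal noise)).toReal

/-- The conditional area spectral efficiency at density `l`. -/
def ASE (l : ℝ) (ω : Ω) : ℝ :=
  l * Real.logb 2 (1 + SINR L noise N X g h l ω)

end Performance

/-- The conditional quantity `E` and its mean tend to infinity at the scale `s`: divided by `s`,
they converge (almost surely for `E`) to the same positive finite deterministic constant. -/
def GrowsAtScale {Ω : Type*} [MeasurableSpace Ω] (P : Measure Ω) (E : ℝ → Ω → ℝ)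
    (s : ℝ → ℝ) : Prop :=
  (∀ᵐ ω ∂P, Tendsto (fun l => E l ω) atTop atTop) ∧
  Tendsto (fun l => ∫ ω, E l ω ∂P) atTop atTop ∧
  ∃ C : ℝ, 0 < C ∧
    (∀ᵐ ω ∂P, Tendsto (fun l => E l ω / s l) atTop (𝓝 C)) ∧
    Tendsto (fun l => (∫ ω, E l ω ∂P) / s l) atTop (𝓝 C)

end

/-! Write κ = L(0)/μ with μ = ∫ L(‖x‖) dx over the plane. The SINR factors as G · W · κN/l
(`SINR_eq`), where G is the average of the |h_j|² over the antennas and W collects the serving path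
gain and the reciprocal of interference plus noise, normalized by L(0) and μl. Both G and W tend to
1, so the candidate for the growth is `growth` = l log₂(1 + κN/l). By Bernoulli's inequality |log(1
+ uy)/log(1 + y) - 1| ≤ |u - 1| uniformly in y > 0 (`abs_log_one_add_mul_div_sub_one_le`), hence
|ASE/growth - 1| ≤ |GW - 1| whatever the relation between N and l. The three regimes then only
concern the deterministic function `growth`.

Almost surely, G → 1 is the strong law, and W → 1 follows from serving distance → 0 and
interference/l → μ. Both come from a law of large numbers for marked Poisson sums
(`IsExpMarkedPoisson.tendsto_markedSum_div`): the variance formula gives summable errors along the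
densities k², and monotonicity in the density fills the gaps.

For the mean one needs E|GW - 1| → 0. The difficulty is weak interference, where W may be of order
l/noise. A Chernoff bound (`IsExpMarkedPoisson.measure_interference_lt_le`) makes the event that the
interference is below δl exponentially unlikely. Off this event W is bounded and dominated
convergence applies; on it a crude polynomial bound suffices. `deviationBound` combines the two
cases. -/

noncomputable section

/-! ### Moments of the exponential and Poisson laws -/

lemma lintegral_expMeasure {f : ℝ → ℝ≥0∞} (hf : Measurable f) :
    ∫⁻ x, f x ∂(expMeasure 1) = ∫⁻ x, gammaPDF 1 1 x * f x := by
  rw [expMeasure, gammaMeasure, lintegral_withDensity_eq_lintegral_mul₀]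
  · rfl
  · exact (measurable_gammaPDFReal 1 1).ennreal_ofReal.aemeasurable
  · exact hf.aemeasurable

/-- Multiplying the exponential density by x gives the gamma density of shape 2, whose total mass is
1. The second moment uses shape 3 in the same way, with Γ(3) = 2 as the factor. -/
lemma lintegral_id_expMeasure : ∫⁻ x, ENNReal.ofReal x ∂(expMeasure 1) = 1 := by
  rw [lintegral_expMeasure (by fun_prop), ← lintegral_gammaPDF_eq_one (a := 2) (r := 1)
    (by norm_num) (by norm_num)]
  refine lintegral_congr fun x => ?_
  rcases lt_or_ge x 0 with hx | hx
  · simp [gammaPDF_of_neg hx]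
  · rw [gammaPDF_of_nonneg hx, gammaPDF_of_nonneg hx, ← ENNReal.ofReal_mul (by positivity)]
    congr 1
    norm_num
    ring

lemma lintegral_sq_expMeasure : ∫⁻ x, ENNReal.ofReal x ^ 2 ∂(expMeasure 1) = 2 := by
  rw [lintegral_expMeasure (by fun_prop), ← mul_one (2 : ℝ≥0∞),
    ← lintegral_gammaPDF_eq_one (a := 3) (r := 1)
    (by norm_num) (by norm_num), ← lintegral_const_mul' _ _ (by norm_num)]
  refine lintegral_congr fun x => ?_
  rcases lt_or_ge x 0 with hx | hx
  · simp [gammaPDF_of_neg hx]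
  · rw [gammaPDF_of_nonneg hx, gammaPDF_of_nonneg hx, ← ENNReal.ofReal_pow hx,
      ← ENNReal.ofReal_mul (by positivity), ← ENNReal.ofReal_ofNat,
      ← ENNReal.ofReal_mul (by norm_num)]
    congr 1
    have : Real.Gamma 3 = 2 := by simp
    rw [this]
    norm_num
    ring

/-- The integrand is half the density of rate 2. The `max` matches the truncation that
`ENNReal.ofReal` applies to the marks in `markedSum`. -/
lemma lintegral_exp_neg_expMeasure :
    ∫⁻ x, ENNReal.ofReal (Real.exp (-max x 0)) ∂(expMeasure 1) = 2⁻¹ := by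
  rw [lintegral_expMeasure (by fun_prop), ← mul_one 2⁻¹,
    ← lintegral_gammaPDF_eq_one (a := 1) (r := 2)
    (by norm_num) (by norm_num), ← lintegral_const_mul' _ _ (by norm_num)]
  refine lintegral_congr fun x => ?_
  rcases lt_or_ge x 0 with hx | hx
  · simp [gammaPDF_of_neg hx]
  · rw [gammaPDF_of_nonneg hx, gammaPDF_of_nonneg hx, max_eq_left hx,
      ← ENNReal.ofReal_mul (by positivity), ← ENNReal.ofReal_ofNat,
      ← ENNReal.ofReal_inv_of_pos (by norm_num), ← ENNReal.ofReal_mul (by norm_num)]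
    refine congrArg ENNReal.ofReal ?_
    simp only [Real.Gamma_one, Real.rpow_one, sub_self, Real.rpow_zero]
    rw [show -(2 * x) = -(1 * x) + -x by ring, Real.exp_add]
    ring

/-- The weight of `k` under the Poisson law of mean `r`. -/
def poissonWeight (r : ℝ≥0) (k : ℕ) : ℝ≥0∞ := ENNReal.ofReal (Real.exp (-r) * r ^ k / k.factorial)

lemma lintegral_poissonMeasure (r : ℝ≥0) (f : ℕ → ℝ≥0∞) :
    ∫⁻ k, f k ∂(poissonMeasure r) = ∑' k, poissonWeight r k * f k := by
  rw [lintegral_countable']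
  refine tsum_congr fun k => ?_
  rw [poissonMeasure_singleton, mul_comm]
  rfl

lemma tsum_poissonWeight (r : ℝ≥0) : ∑' k, poissonWeight r k = 1 := by
  have := (hasSum_one_poissonMeasure r)
  unfold poissonWeight
  rw [← ENNReal.ofReal_tsum_of_nonneg (fun n => by positivity) this.summable, this.tsum_eq,
    ENNReal.ofReal_one]

/-- Size biasing: a factor k shifts the Poisson weights by one, which yields the first two moments.
-/
lemma poissonWeight_succ (r : ℝ≥0) (k : ℕ) :
    poissonWeight r (k + 1) * ((k + 1 : ℕ) : ℝ≥0∞) = r * poissonWeight r k := by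
  unfold poissonWeight
  rw [← ENNReal.ofReal_natCast, ← ENNReal.ofReal_coe_nnreal, ← ENNReal.ofReal_mul (by positivity),
    ← ENNReal.ofReal_mul (by positivity)]
  congr 1
  rw [Nat.factorial_succ]
  push_cast
  field_simp
  ring

lemma lintegral_natCast_poissonMeasure (r : ℝ≥0) :
    ∫⁻ k, (k : ℝ≥0∞) ∂(poissonMeasure r) = r := by
  rw [lintegral_poissonMeasure, tsum_eq_zero_add' ENNReal.summable]
  simp_rw [poissonWeight_succ, ENNReal.tsum_mul_left, tsum_poissonWeight]
  simp

lemma lintegral_natCast_sq_poissonMeasure (r : ℝ≥0) :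
    ∫⁻ k, (k : ℝ≥0∞) ^ 2 ∂(poissonMeasure r) = r ^ 2 + r := by
  rw [lintegral_poissonMeasure, tsum_eq_zero_add' ENNReal.summable]
  simp_rw [pow_two, ← mul_assoc, poissonWeight_succ, mul_assoc, ENNReal.tsum_mul_left]
  push_cast
  simp_rw [mul_add, mul_one, ENNReal.tsum_add, tsum_poissonWeight, ← lintegral_poissonMeasure,
    lintegral_natCast_poissonMeasure]
  simp [mul_add]

/-- Tilting the Poisson weights of mean r by 2⁻ᵏ gives e^(-r/2) times the weights of mean r/2. -/
lemma lintegral_pow_inv_two_poissonMeasure (r : ℝ≥0) :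
    ∫⁻ k, (2⁻¹ : ℝ≥0∞) ^ k ∂(poissonMeasure r) = ENNReal.ofReal (Real.exp (-(r / 2))) := by
  rw [lintegral_poissonMeasure]
  have : ∀ k, poissonWeight r k * (2⁻¹ : ℝ≥0∞) ^ k =
      ENNReal.ofReal (Real.exp (-(r / 2))) * poissonWeight (r / 2) k := by
    intro k
    unfold poissonWeight
    rw [← ENNReal.ofReal_ofNat, ← ENNReal.ofReal_inv_of_pos (by norm_num),
      ← ENNReal.ofReal_pow (by norm_num), ← ENNReal.ofReal_mul (by positivity),
      ← ENNReal.ofReal_mul (by positivity)]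
    congr 1
    have : Real.exp (-r) = Real.exp (-(r / 2)) * Real.exp (-(r / 2)) := by
      rw [← Real.exp_add]; congr 1; ring
    rw [this]
    push_cast
    rw [div_pow, inv_pow]
    field_simp
  simp_rw [this, ENNReal.tsum_mul_left, tsum_poissonWeight, mul_one]

/-! ### First and second moments of sums over a Poisson process -/

/-- Exhaust by the spanning sets of ν. This form is needed because a Poisson process prescribes its
counts only on sets of finite intensity. -/
lemma MeasureTheory.Measure.ext_of_finite_on {E : Type*} [MeasurableSpace E] {ν μ₁ μ₂ : Measure E}
    [SigmaFinite ν] (h : ∀ A, MeasurableSet A → ν A ≠ ∞ → μ₁ A = μ₂ A) : μ₁ = μ₂ := by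
  refine Measure.ext fun A hA => ?_
  have key : ∀ μ : Measure E, μ A = ⨆ n, μ (A ∩ spanningSets ν n) := fun μ => by
    rw [← Monotone.measure_iUnion, ← inter_iUnion, iUnion_spanningSets, inter_univ]
    exact fun i j hij => inter_subset_inter_right _ (monotone_spanningSets ν hij)
  rw [key, key]
  refine iSup_congr fun n => h _ (hA.inter (measurableSet_spanningSets ν n)) ?_
  exact ((measure_mono inter_subset_right).trans_lt (measure_spanningSets_lt_top ν n)).ne

section Campbell

variable {Ω E : Type*} [MeasurableSpace Ω] [MeasurableSpace E] {X : ℕ → Ω → E} {ν : Measure E}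
  {P : Measure Ω}

lemma measurable_tsum_comp (hX : ∀ n, Measurable (X n)) {f : E → ℝ≥0∞} (hf : Measurable f) :
    Measurable fun ω => ∑' n, f (X n ω) :=
  Measurable.tsum fun n => hf.comp (hX n)

lemma measurable_pointCount (hX : ∀ n, Measurable (X n)) {A : Set E} (hA : MeasurableSet A) :
    Measurable (pointCount X A) :=
  measurable_tsum_comp hX (measurable_const.indicator hA)

lemma pointCount_add {Ω E : Type*} {X : ℕ → Ω → E} (A B : Set E) (hAB : Disjoint A B) (ω : Ω) :
    pointCount X (A ∪ B) ω = pointCount X A ω + pointCount X B ω := by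
  unfold pointCount
  rw [← ENNReal.tsum_add]
  refine tsum_congr fun n => ?_
  rw [indicator_union_of_disjoint hAB]

lemma lintegral_comp_pointCount (h : IsPoissonProcess X ν P) {A : Set E} (hA : MeasurableSet A)
    (hfin : ν A ≠ ∞) {f : ℝ≥0∞ → ℝ≥0∞} (hf : Measurable f) :
    ∫⁻ ω, f (pointCount X A ω) ∂P = ∫⁻ k : ℕ, f k ∂(poissonMeasure (ν A).toNNReal) := by
  rw [(h.law A hA hfin).lintegral_comp hf.aemeasurable, lintegral_map hf (by fun_prop)]

lemma lintegral_pointCount (h : IsPoissonProcess X ν P) {A : Set E} (hA : MeasurableSet A)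
    (hfin : ν A ≠ ∞) : ∫⁻ ω, pointCount X A ω ∂P = ν A := by
  rw [lintegral_comp_pointCount h hA hfin (f := fun x => x) measurable_id]
  simp [lintegral_natCast_poissonMeasure, hfin]

lemma lintegral_pointCount_sq (h : IsPoissonProcess X ν P) {A : Set E} (hA : MeasurableSet A)
    (hfin : ν A ≠ ∞) : ∫⁻ ω, pointCount X A ω ^ 2 ∂P = ν A ^ 2 + ν A := by
  rw [lintegral_comp_pointCount h hA hfin (f := fun x => x ^ 2) (by fun_prop),
    lintegral_natCast_sq_poissonMeasure]
  simp [hfin]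

lemma lintegral_pointCount_mul_of_disjoint (h : IsPoissonProcess X ν P) {A B : Set E}
    (hA : MeasurableSet A) (hB : MeasurableSet B) (hAB : Disjoint A B) (hAfin : ν A ≠ ∞)
    (hBfin : ν B ≠ ∞) :
    ∫⁻ ω, pointCount X A ω * pointCount X B ω ∂P = ν A * ν B := by
  have hind := h.indep 2 ![A, B] (by simp [Fin.forall_fin_two, hA, hB])
    (by intro i j hij; fin_cases i <;> fin_cases j <;> simp_all [hAB.symm])
  have := hind.indepFun (i := 0) (j := 1) (by simp)
  simp only [Matrix.cons_val_zero, Matrix.cons_val_one] at this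
  have h2 := lintegral_mul_eq_lintegral_mul_lintegral_of_indepFun
    (measurable_pointCount h.measurable hA) (measurable_pointCount h.measurable hB) this
  simp only [Pi.mul_apply] at h2
  rw [h2, lintegral_pointCount h hA hAfin, lintegral_pointCount h hB hBfin]

/-- Cut A and B into A ∩ B, A \ B and B \ A and expand the product. Counts of disjoint pieces are
independent, and the square of the count of A ∩ B contributes the extra term ν(A ∩ B). -/
lemma lintegral_pointCount_mul (h : IsPoissonProcess X ν P) {A B : Set E}
    (hA : MeasurableSet A) (hB : MeasurableSet B) (hAfin : ν A ≠ ∞) (hBfin : ν B ≠ ∞) :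
    ∫⁻ ω, pointCount X A ω * pointCount X B ω ∂P = ν A * ν B + ν (A ∩ B) := by
  have hC := hA.inter hB
  have hD := hA.diff hB
  have hF := hB.diff hA
  have hCfin : ν (A ∩ B) ≠ ∞ := measure_ne_top_of_subset inter_subset_left hAfin
  have hDfin : ν (A \ B) ≠ ∞ := measure_ne_top_of_subset sdiff_subset hAfin
  have hFfin : ν (B \ A) ≠ ∞ := measure_ne_top_of_subset sdiff_subset hBfin
  have hCD : Disjoint (A ∩ B) (A \ B) := by
    rw [Set.disjoint_left]; intro x hx hx'; exact hx'.2 hx.2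
  have hCF : Disjoint (A ∩ B) (B \ A) := by
    rw [Set.disjoint_left]; intro x hx hx'; exact hx'.2 hx.1
  have hDF : Disjoint (A \ B) (B \ A) := by
    rw [Set.disjoint_left]; intro x hx hx'; exact hx'.2 hx.1
  have e1 : A = (A ∩ B) ∪ (A \ B) := (inter_union_sdiff A B).symm
  have e2 : B = (A ∩ B) ∪ (B \ A) := by rw [inter_comm]; exact (inter_union_sdiff B A).symm
  have n1 : ν A = ν (A ∩ B) + ν (A \ B) := (measure_inter_add_sdiff A hB).symm
  have n2 : ν B = ν (A ∩ B) + ν (B \ A) := by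
    rw [inter_comm]; exact (measure_inter_add_sdiff B hA).symm
  have mC := measurable_pointCount h.measurable hC
  have mD := measurable_pointCount h.measurable hD
  have mF := measurable_pointCount h.measurable hF
  have : ∀ ω, pointCount X A ω * pointCount X B ω = pointCount X (A ∩ B) ω ^ 2 +
      pointCount X (A ∩ B) ω * pointCount X (B \ A) ω +
      pointCount X (A ∩ B) ω * pointCount X (A \ B) ω +
      pointCount X (A \ B) ω * pointCount X (B \ A) ω := by
    intro ω
    have p1 := pointCount_add (X := X) _ _ hCD ω
    have p2 := pointCount_add (X := X) _ _ hCF ω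
    rw [← e1] at p1
    rw [← e2] at p2
    rw [p1, p2]
    ring
  simp_rw [this]
  rw [lintegral_add_left (by fun_prop), lintegral_add_left (by fun_prop),
    lintegral_add_left (by fun_prop), lintegral_pointCount_sq h hC hCfin,
    lintegral_pointCount_mul_of_disjoint h hC hF hCF hCfin hFfin,
    lintegral_pointCount_mul_of_disjoint h hC hD hCD hCfin hDfin,
    lintegral_pointCount_mul_of_disjoint h hD hF hDF hDfin hFfin, n1, n2]
  ring

/-- With Z fixed, the expectation is the integral of f against one measure (a Campbell measure).
Identifying that measure on sets therefore settles all f at once. -/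
lemma lintegral_tsum_mul_eq_lintegral_sum_map (hX : ∀ n, Measurable (X n)) {f : E → ℝ≥0∞}
    (hf : Measurable f) {Z : Ω → ℝ≥0∞} (hZ : Measurable Z) :
    ∫⁻ ω, (∑' n, f (X n ω)) * Z ω ∂P =
      ∫⁻ x, f x ∂(Measure.sum fun n => (P.withDensity Z).map (X n)) := by
  rw [lintegral_sum_measure]
  simp_rw [fun n => lintegral_map hf (hX n) (μ := P.withDensity Z)]
  rw [← lintegral_tsum (f := fun n ω => f (X n ω)) fun n => (hf.comp (hX n)).aemeasurable,
    lintegral_withDensity_eq_lintegral_mul _ hZ (measurable_tsum_comp hX hf)]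
  simp only [Pi.mul_apply, mul_comm]

lemma sum_map_apply (hX : ∀ n, Measurable (X n)) {Z : Ω → ℝ≥0∞} (hZ : Measurable Z) {A : Set E}
    (hA : MeasurableSet A) :
    (Measure.sum fun n => (P.withDensity Z).map (X n)) A = ∫⁻ ω, pointCount X A ω * Z ω ∂P := by
  rw [← lintegral_indicator_one hA]
  exact (lintegral_tsum_mul_eq_lintegral_sum_map hX (measurable_const.indicator hA) hZ).symm

/-- Campbell's formula. -/
lemma lintegral_tsum_poisson [SigmaFinite ν] (h : IsPoissonProcess X ν P) {f : E → ℝ≥0∞}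
    (hf : Measurable f) : ∫⁻ ω, ∑' n, f (X n ω) ∂P = ∫⁻ x, f x ∂ν := by
  have := lintegral_tsum_mul_eq_lintegral_sum_map (P := P) h.measurable hf
    (Z := fun _ => 1) measurable_const
  simp only [mul_one] at this
  rw [this]
  congr 1
  refine Measure.ext_of_finite_on (ν := ν) fun A hA hfin => ?_
  rw [sum_map_apply h.measurable measurable_const hA]
  simp [lintegral_pointCount h hA hfin]

/-- The second moment formula is reached one factor at a time: here one factor is still a count, and
the product formula for counts identifies the Campbell measure. -/
lemma lintegral_tsum_mul_pointCount [SigmaFinite ν] (h : IsPoissonProcess X ν P) {f : E → ℝ≥0∞}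
    (hf : Measurable f) {B : Set E} (hB : MeasurableSet B) (hBfin : ν B ≠ ∞) :
    ∫⁻ ω, (∑' n, f (X n ω)) * pointCount X B ω ∂P = (∫⁻ x, f x ∂ν) * ν B + ∫⁻ x in B, f x ∂ν := by
  have hm := measurable_pointCount h.measurable hB
  rw [lintegral_tsum_mul_eq_lintegral_sum_map h.measurable hf hm]
  have : (Measure.sum fun n => (P.withDensity (pointCount X B)).map (X n)) =
      ν B • ν + ν.restrict B := by
    refine Measure.ext_of_finite_on (ν := ν) fun A hA hfin => ?_
    rw [sum_map_apply h.measurable hm hA, lintegral_pointCount_mul h hA hB hfin hBfin]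
    simp [Measure.restrict_apply hA, mul_comm]
  rw [this, lintegral_add_measure, lintegral_smul_measure, smul_eq_mul, mul_comm]

/-- The second moment formula for sums over a Poisson process. -/
lemma lintegral_tsum_mul_tsum_poisson [SigmaFinite ν] (h : IsPoissonProcess X ν P)
    {f k : E → ℝ≥0∞} (hf : Measurable f) (hk : Measurable k) :
    ∫⁻ ω, (∑' n, k (X n ω)) * (∑' n, f (X n ω)) ∂P =
      (∫⁻ x, k x ∂ν) * (∫⁻ x, f x ∂ν) + ∫⁻ x, k x * f x ∂ν := by
  have hm := measurable_tsum_comp h.measurable hf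
  rw [lintegral_tsum_mul_eq_lintegral_sum_map h.measurable hk hm]
  -- Now the weight is the full sum over f, and the previous lemma evaluates the Campbell measure on
  -- sets.
  have : (Measure.sum fun n => (P.withDensity fun ω => ∑' n, f (X n ω)).map (X n)) =
      (∫⁻ x, f x ∂ν) • ν + ν.withDensity f := by
    refine Measure.ext_of_finite_on (ν := ν) fun A hA hfin => ?_
    rw [sum_map_apply h.measurable hm hA]
    simp_rw [mul_comm (pointCount X A _)]
    rw [lintegral_tsum_mul_pointCount h hf hA hfin]
    simp [withDensity_apply _ hA]
  rw [this, lintegral_add_measure, lintegral_smul_measure, smul_eq_mul, mul_comm,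
    lintegral_withDensity_eq_lintegral_mul _ hf hk]
  simp only [Pi.mul_apply, mul_comm]

end Campbell

/-! ### Sums over an independently marked Poisson process -/

/-- Pass to measurable versions; the marks are known to be measurable only almost everywhere. -/
lemma lintegral_prod_eq_prod_lintegral_of_iIndepFun {Ω ι : Type*} [MeasurableSpace Ω]
    {P : Measure Ω} [Countable ι] (s : Finset ι) (Y : ι → Ω → ℝ≥0∞) (hY : iIndepFun Y P)
    (hm : ∀ i, AEMeasurable (Y i) P) :
    ∫⁻ ω, ∏ i ∈ s, Y i ω ∂P = ∏ i ∈ s, ∫⁻ ω, Y i ω ∂P := by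
  have h1 : iIndepFun (fun i => (hm i).mk (Y i)) P :=
    hY.congr fun i => (hm i).ae_eq_mk
  have h2 := lintegral_prod_eq_prod_lintegral_of_indepFun s _ h1 fun i => (hm i).measurable_mk
  rw [Finset.prod_congr rfl fun i _ => lintegral_congr_ae (hm i).ae_eq_mk, ← h2]
  refine lintegral_congr_ae ?_
  filter_upwards [ae_all_iff.2 fun i => (hm i).ae_eq_mk] with ω hω
  exact Finset.prod_congr rfl fun i _ => hω i

/-- Fubini on the product law. It allows the marks to be integrated out with the points frozen. -/
lemma lintegral_indepFun_eq_lintegral_lintegral {Ω α β : Type*} [MeasurableSpace Ω]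
    [MeasurableSpace α] [MeasurableSpace β] {P : Measure Ω} [IsProbabilityMeasure P]
    {X : Ω → α} {Y : Ω → β} (hX : AEMeasurable X P) (hY : AEMeasurable Y P) (h : IndepFun X Y P)
    {H : α → β → ℝ≥0∞} (hH : Measurable (Function.uncurry H)) :
    ∫⁻ ω, H (X ω) (Y ω) ∂P = ∫⁻ ω, ∫⁻ ω', H (X ω) (Y ω') ∂P ∂P := by
  have hmap := (indepFun_iff_map_prod_eq_prod_map_map hX hY).1 h
  have e1 : ∫⁻ ω, H (X ω) (Y ω) ∂P = ∫⁻ z, Function.uncurry H z ∂(P.map fun ω => (X ω, Y ω)) := by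
    rw [lintegral_map' hH.aemeasurable (hX.prodMk hY)]
    rfl
  have := Measure.isProbabilityMeasure_map hX
  have := Measure.isProbabilityMeasure_map hY
  rw [e1, hmap, lintegral_prod _ hH.aemeasurable, lintegral_map' ?_ hX]
  · refine lintegral_congr fun ω => ?_
    rw [lintegral_map' ?_ hY]
    · rfl
    · exact (hH.comp measurable_prodMk_left).aemeasurable
  · exact (hH.lintegral_prod_right').aemeasurable

/-- `X` enumerates a Poisson process with intensity `ν`, and `g` are independent exponential marks
that are independent of the process. -/
structure IsExpMarkedPoisson {Ω E : Type*} [MeasurableSpace Ω] [MeasurableSpace E]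
    (X : ℕ → Ω → E) (g : ℕ → Ω → ℝ) (ν : Measure E) (P : Measure Ω) : Prop where
  poisson : IsPoissonProcess X ν P
  law : ∀ n, HasLaw (g n) (expMeasure 1) P
  indep : iIndepFun g P
  indep_points : IndepFun (fun ω n => X n ω) (fun ω n => g n ω) P

/-- The sum of `f` over the points, each term multiplied by the mark of the point. -/
def markedSum {Ω E : Type*} (X : ℕ → Ω → E) (g : ℕ → Ω → ℝ) (f : E → ℝ≥0∞) (ω : Ω) : ℝ≥0∞ :=
  ∑' n, f (X n ω) * ENNReal.ofReal (g n ω)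

lemma markedSum_mono {Ω E : Type*} {X : ℕ → Ω → E} {g : ℕ → Ω → ℝ} {f f' : E → ℝ≥0∞}
    (h : f ≤ f') (ω : Ω) : markedSum X g f ω ≤ markedSum X g f' ω :=
  ENNReal.tsum_le_tsum fun n => mul_le_mul_left (h (X n ω)) _

namespace IsExpMarkedPoisson

variable {Ω E : Type*} [MeasurableSpace Ω] [MeasurableSpace E] {X : ℕ → Ω → E} {g : ℕ → Ω → ℝ}
  {ν : Measure E} {P : Measure Ω}

lemma aemeasurable_mark (h : IsExpMarkedPoisson X g ν P) (n : ℕ) :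
    AEMeasurable (fun ω => ENNReal.ofReal (g n ω)) P :=
  (h.law n).aemeasurable.ennreal_ofReal

lemma aemeasurable_markedSum (h : IsExpMarkedPoisson X g ν P) {f : E → ℝ≥0∞} (hf : Measurable f) :
    AEMeasurable (markedSum X g f) P :=
  AEMeasurable.tsum fun n =>
    ((hf.comp (h.poisson.measurable n)).aemeasurable).fun_mul (h.aemeasurable_mark n)

lemma lintegral_mark (h : IsExpMarkedPoisson X g ν P) (n : ℕ) :
    ∫⁻ ω, ENNReal.ofReal (g n ω) ∂P = 1 := by
  rw [(h.law n).lintegral_comp (f := fun x => ENNReal.ofReal x) (by fun_prop),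
    lintegral_id_expMeasure]

lemma lintegral_mark_mul_mark (h : IsExpMarkedPoisson X g ν P) (n m : ℕ) :
    ∫⁻ ω, ENNReal.ofReal (g n ω) * ENNReal.ofReal (g m ω) ∂P = 1 + if m = n then 1 else 0 := by
  by_cases hnm : m = n
  · subst hnm
    simp_rw [← pow_two]
    rw [(h.law m).lintegral_comp (f := fun x => ENNReal.ofReal x ^ 2) (by fun_prop),
      lintegral_sq_expMeasure]
    simp [one_add_one_eq_two]
  · rw [lintegral_mul_eq_lintegral_mul_lintegral_of_indepFun'' (h.aemeasurable_mark n)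
      (h.aemeasurable_mark m) ((h.indep.indepFun (Ne.symm hnm)).comp ENNReal.measurable_ofReal
        ENNReal.measurable_ofReal), h.lintegral_mark, h.lintegral_mark]
    simp [hnm]

lemma lintegral_markedSum [SigmaFinite ν] (h : IsExpMarkedPoisson X g ν P) {f : E → ℝ≥0∞}
    (hf : Measurable f) : ∫⁻ ω, markedSum X g f ω ∂P = ∫⁻ x, f x ∂ν := by
  have hm : ∀ n, AEMeasurable (fun ω => f (X n ω)) P :=
    fun n => (hf.comp (h.poisson.measurable n)).aemeasurable
  unfold markedSum
  rw [lintegral_tsum fun n => (hm n).fun_mul (h.aemeasurable_mark n),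
    ← lintegral_tsum_poisson h.poisson hf,
    lintegral_tsum hm]
  refine tsum_congr fun n => ?_
  rw [lintegral_mul_eq_lintegral_mul_lintegral_of_indepFun'' (hm n) (h.aemeasurable_mark n)
    (h.indep_points.comp (φ := fun x : ℕ → E => f (x n))
      (ψ := fun y : ℕ → ℝ => ENNReal.ofReal (y n))
      (by fun_prop) (by fun_prop)), h.lintegral_mark, mul_one]

/-- Off the diagonal the marks contribute the factor 1, on it E g² = 2. The unmarked second moment
already contains ∫ f² once from the diagonal, and the excess in the marks adds it a second time. -/
lemma lintegral_markedSum_sq [SigmaFinite ν] (h : IsExpMarkedPoisson X g ν P) {f : E → ℝ≥0∞}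
    (hf : Measurable f) :
    ∫⁻ ω, markedSum X g f ω ^ 2 ∂P = (∫⁻ x, f x ∂ν) ^ 2 + 2 * ∫⁻ x, f x ^ 2 ∂ν := by
  have hm : ∀ n, AEMeasurable (fun ω => f (X n ω)) P :=
    fun n => (hf.comp (h.poisson.measurable n)).aemeasurable
  have hexp : ∀ (a : ℕ → ℝ≥0∞), (∑' n, a n) ^ 2 = ∑' n, ∑' m, a n * a m := fun a => by
    rw [pow_two, ← ENNReal.tsum_mul_right]
    simp_rw [ENNReal.tsum_mul_left]
  have hterm : ∀ n m, ∫⁻ ω, f (X n ω) * ENNReal.ofReal (g n ω) *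
      (f (X m ω) * ENNReal.ofReal (g m ω)) ∂P =
      ∫⁻ ω, f (X n ω) * f (X m ω) ∂P + if m = n then ∫⁻ ω, f (X n ω) ^ 2 ∂P else 0 := by
    intro n m
    have : ∀ ω, f (X n ω) * ENNReal.ofReal (g n ω) * (f (X m ω) * ENNReal.ofReal (g m ω)) =
      f (X n ω) * f (X m ω) * (ENNReal.ofReal (g n ω) * ENNReal.ofReal (g m ω)) := fun ω => by ring
    simp_rw [this]
    rw [lintegral_mul_eq_lintegral_mul_lintegral_of_indepFun'' ((hm n).fun_mul (hm m))
      ((h.aemeasurable_mark n).fun_mul (h.aemeasurable_mark m))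
      (h.indep_points.comp (φ := fun x : ℕ → E => f (x n) * f (x m))
        (ψ := fun y : ℕ → ℝ => ENNReal.ofReal (y n) * ENNReal.ofReal (y m))
      (by fun_prop) (by fun_prop)), h.lintegral_mark_mul_mark]
    by_cases hnm : m = n
    · subst hnm; simp [mul_add, pow_two]
    · simp [hnm]
  have h2 := lintegral_tsum_mul_tsum_poisson h.poisson hf hf
  simp_rw [← pow_two, hexp] at h2
  unfold markedSum
  simp_rw [hexp]
  rw [two_mul, ← add_assoc, ← h2, ← lintegral_tsum_poisson h.poisson (hf.pow_const 2),
    lintegral_tsum (f := fun n ω => f (X n ω) ^ 2) fun n => (hm n).pow_const 2,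
    lintegral_tsum, lintegral_tsum, ← ENNReal.tsum_add]
  · refine tsum_congr fun n => ?_
    rw [lintegral_tsum, lintegral_tsum]
    · simp_rw [hterm, ENNReal.tsum_add, tsum_ite_eq]
    · exact fun m => (hm n).fun_mul (hm m)
    · exact fun m => ((hm n).fun_mul (h.aemeasurable_mark n)).fun_mul
        ((hm m).fun_mul (h.aemeasurable_mark m))
  · exact fun n => AEMeasurable.tsum fun m => (hm n).fun_mul (hm m)
  · exact fun n => AEMeasurable.tsum fun m =>
      ((hm n).fun_mul (h.aemeasurable_mark n)).fun_mul ((hm m).fun_mul (h.aemeasurable_mark m))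

/-- The variance of a marked Poisson sum. -/
lemma lintegral_markedSum_sub_sq [SigmaFinite ν] [IsProbabilityMeasure P]
    (h : IsExpMarkedPoisson X g ν P) {f : E → ℝ≥0∞}
    (hf : Measurable f) (hfin : ∫⁻ x, f x ∂ν ≠ ∞) :
    ∫⁻ ω, ENNReal.ofReal (((markedSum X g f ω).toReal - (∫⁻ x, f x ∂ν).toReal) ^ 2) ∂P =
      2 * ∫⁻ x, f x ^ 2 ∂ν := by
  obtain ⟨a, ha⟩ : ∃ a, a = ∫⁻ x, f x ∂ν := ⟨_, rfl⟩
  rw [← ha] at hfin ⊢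
  have hS := h.aemeasurable_markedSum hf
  have hlt : ∀ᵐ ω ∂P, markedSum X g f ω < ∞ :=
    ae_lt_top' hS (by rwa [h.lintegral_markedSum hf, ← ha])
  -- The cross term stands on the left so that no truncated subtraction occurs; it is cancelled,
  -- being finite, after integration.
  have hpt : ∀ᵐ ω ∂P, ENNReal.ofReal (((markedSum X g f ω).toReal - a.toReal) ^ 2) +
      2 * a * markedSum X g f ω = markedSum X g f ω ^ 2 + a ^ 2 := by
    filter_upwards [hlt] with ω hω
    clear ha
    lift a to ℝ≥0 using hfin
    generalize markedSum X g f ω = s at hω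
    lift s to ℝ≥0 using hω.ne
    have e1 : (2 * (a : ℝ≥0∞) * s) = ENNReal.ofReal (2 * a * s) := by
      rw [ENNReal.ofReal_mul (by positivity), ENNReal.ofReal_mul (by positivity)]; simp
    have e2 : ((s : ℝ≥0∞) ^ 2 + (a : ℝ≥0∞) ^ 2) = ENNReal.ofReal (s ^ 2 + a ^ 2) := by
      rw [ENNReal.ofReal_add (by positivity) (by positivity), ENNReal.ofReal_pow (by positivity),
        ENNReal.ofReal_pow (by positivity)]; simp
    rw [e1, e2, ← ENNReal.ofReal_add (by positivity) (by positivity)]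
    congr 1
    simp only [ENNReal.coe_toReal]
    ring
  have hint := lintegral_congr_ae hpt
  rw [lintegral_add_right' _ (hS.const_mul _), lintegral_add_right' _ aemeasurable_const,
    lintegral_const_mul'' _ hS, h.lintegral_markedSum hf, h.lintegral_markedSum_sq hf, ← ha] at hint
  have h2 : 2 * a * a ≠ ∞ := ENNReal.mul_ne_top (ENNReal.mul_ne_top (by norm_num) hfin) hfin
  refine (ENNReal.add_left_inj h2).1 ?_
  rw [hint]
  simp
  ring

/-- Exponential lower tail of the sum of the marks of the points in a set. -/
lemma measure_markedSum_lt_le [IsProbabilityMeasure P] (h : IsExpMarkedPoisson X g ν P) {A : Set E}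
    (hA : MeasurableSet A) (hfin : ν A ≠ ∞) (a : ℝ) :
    P {ω | markedSum X g (A.indicator 1) ω < ENNReal.ofReal a} ≤
      ENNReal.ofReal (Real.exp (a - (ν A).toReal / 2)) := by
  classical
  set c : E → ℝ := A.indicator 1 with hc
  have hcm : Measurable c := measurable_const.indicator hA
  have hc0 : ∀ x, 0 ≤ c x := fun x => indicator_nonneg (fun _ _ => zero_le_one) x
  have hcoe : ∀ x, (A.indicator 1 x : ℝ≥0∞) = ENNReal.ofReal (c x) := fun x => by
    by_cases hx : x ∈ A <;> simp [hc, hx]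
  have hgm : AEMeasurable (fun ω n => g n ω) P :=
    aemeasurable_pi_lambda _ fun n => (h.law n).aemeasurable
  have hXm : Measurable (fun ω n => X n ω) := measurable_pi_lambda _ h.poisson.measurable
  -- Integrating out the mark of a point of A costs a factor 1/2 = exp(-log 2); points outside A
  -- cost nothing.
  have hlap : ∀ x n, ∫⁻ ω, ENNReal.ofReal (Real.exp (-(c x * max (g n ω) 0))) ∂P =
      ENNReal.ofReal (Real.exp (-(c x * Real.log 2))) := by
    intro x n
    by_cases hx : x ∈ A
    · simp only [hc, hx, indicator_of_mem, Pi.one_apply, one_mul]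
      rw [(h.law n).lintegral_comp (f := fun y => ENNReal.ofReal (Real.exp (-max y 0)))
        (by fun_prop), lintegral_exp_neg_expMeasure, Real.exp_neg, Real.exp_log (by norm_num),
        ENNReal.ofReal_inv_of_pos (by norm_num)]
      simp
    · simp [hc, hx]
  let D : ℕ → Ω → ℝ≥0∞ := fun m ω =>
    ∏ n ∈ Finset.range m, ENNReal.ofReal (Real.exp (-(c (X n ω) * max (g n ω) 0)))
  have hexp : ∀ m (b : ℕ → ℝ), ∏ n ∈ Finset.range m, ENNReal.ofReal (Real.exp (-(b n))) =
      ENNReal.ofReal (Real.exp (-∑ n ∈ Finset.range m, b n)) := fun m b => by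
    rw [← Finset.sum_neg_distrib, Real.exp_sum, ENNReal.ofReal_prod_of_nonneg]
    exact fun _ _ => (Real.exp_pos _).le
  have hDm : ∀ m, AEMeasurable (D m) P := fun m =>
    Finset.aemeasurable_fun_prod _ fun n _ =>
      (((((hcm.comp (h.poisson.measurable n)).aemeasurable).mul
        ((h.law n).aemeasurable.max aemeasurable_const)).neg).exp).ennreal_ofReal
  have hDint : ∀ m, ∫⁻ ω, D m ω ∂P =
      ∫⁻ ω, ENNReal.ofReal (Real.exp (-(∑ n ∈ Finset.range m, c (X n ω)) * Real.log 2)) ∂P := by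
    intro m
    have := lintegral_indepFun_eq_lintegral_lintegral hXm.aemeasurable hgm h.indep_points
      (H := fun x y => ∏ n ∈ Finset.range m, ENNReal.ofReal (Real.exp (-(c (x n) * max (y n) 0))))
      (by unfold Function.uncurry; fun_prop)
    refine this.trans (lintegral_congr fun ω => ?_)
    rw [lintegral_prod_eq_prod_lintegral_of_iIndepFun]
    · simp_rw [hlap]
      rw [hexp, ← Finset.sum_mul, neg_mul]
    · exact h.indep.comp (fun n y => ENNReal.ofReal (Real.exp (-(c (X n ω) * max y 0))))
        fun n => by fun_prop
    · exact fun n =>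
        ((((h.law n).aemeasurable.max aemeasurable_const).const_mul _).neg.exp).ennreal_ofReal
  -- Chernoff's bound with finitely many points: partial sums are at most the whole sum, so `D m` is
  -- at least exp(-a) on the event, for every m.
  have hmarkov : ∀ m, P {ω | markedSum X g (A.indicator 1) ω < ENNReal.ofReal a} ≤
      ENNReal.ofReal (Real.exp a) * ∫⁻ ω, D m ω ∂P := by
    intro m
    have h1 : {ω | markedSum X g (A.indicator 1) ω < ENNReal.ofReal a} ⊆
        {ω | ENNReal.ofReal (Real.exp (-a)) ≤ D m ω} := by
      intro ω hω
      simp only [mem_ofPred_eq] at hω ⊢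
      have h2 : ENNReal.ofReal (∑ n ∈ Finset.range m, c (X n ω) * max (g n ω) 0) <
          ENNReal.ofReal a := by
        refine lt_of_le_of_lt ?_ hω
        rw [ENNReal.ofReal_sum_of_nonneg fun n _ => mul_nonneg (hc0 _) (le_max_right _ _)]
        refine le_trans (le_of_eq ?_) (ENNReal.sum_le_tsum (Finset.range m))
        refine Finset.sum_congr rfl fun n _ => ?_
        rw [ENNReal.ofReal_mul (hc0 _), hcoe]
        congr 1
        rcases le_total (g n ω) 0 with h0 | h0
        · simp [h0, ENNReal.ofReal_of_nonpos h0]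
        · simp [h0]
      have h3 := (ENNReal.ofReal_lt_ofReal_iff'.1 h2).1
      simp only [D]
      rw [hexp]
      exact ENNReal.ofReal_le_ofReal (Real.exp_le_exp.2 (by linarith))
    refine (measure_mono h1).trans ?_
    have h4 := mul_meas_ge_le_lintegral₀ (hDm m) (ENNReal.ofReal (Real.exp (-a)))
    calc _ = ENNReal.ofReal (Real.exp a) * (ENNReal.ofReal (Real.exp (-a)) *
          P {ω | ENNReal.ofReal (Real.exp (-a)) ≤ D m ω}) := by
          rw [← mul_assoc, ← ENNReal.ofReal_mul (Real.exp_pos _).le, ← Real.exp_add]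
          simp
      _ ≤ _ := mul_le_mul_right h4 _
  have hNm := measurable_pointCount h.poisson.measurable hA
  have hNfin : ∀ᵐ ω ∂P, pointCount X A ω < ∞ :=
    ae_lt_top hNm (by rwa [lintegral_pointCount h.poisson hA hfin])
  -- After the marks are integrated out, the limit is the expectation of 2 to the power minus the
  -- count, evaluated by the Poisson law in `hval`.
  have hlim : Tendsto (fun m => ∫⁻ ω, D m ω ∂P) atTop
      (𝓝 (∫⁻ ω, ENNReal.ofReal (Real.exp (-(pointCount X A ω).toReal * Real.log 2)) ∂P)) := by
    simp_rw [hDint]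
    refine tendsto_lintegral_of_dominated_convergence (fun _ => 1) (fun m => ?_) (fun m => ?_) ?_ ?_
    · have : ∀ n, Measurable fun ω => c (X n ω) := fun n => hcm.comp (h.poisson.measurable n)
      exact (((Finset.measurable_fun_sum _ fun n _ => this n).neg.mul_const _).exp).ennreal_ofReal
    · refine Eventually.of_forall fun ω => ?_
      rw [← ENNReal.ofReal_one]
      refine ENNReal.ofReal_le_ofReal (Real.exp_le_one_iff.2 ?_)
      have := Finset.sum_nonneg fun n (_ : n ∈ Finset.range m) => hc0 (X n ω)
      have := Real.log_nonneg (x := 2) (by norm_num)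
      rw [neg_mul]
      exact neg_nonpos.2 (by positivity)
    · simp
    · filter_upwards [hNfin] with ω hω
      have h1 : Tendsto (fun m => ∑ n ∈ Finset.range m, (A.indicator 1 (X n ω) : ℝ≥0∞)) atTop
          (𝓝 (pointCount X A ω)) := ENNReal.tendsto_nat_tsum _
      have h2 := (ENNReal.tendsto_toReal hω.ne).comp h1
      have h3 : (fun m => ∑ n ∈ Finset.range m, c (X n ω)) =
          ENNReal.toReal ∘ fun m => ∑ n ∈ Finset.range m, (A.indicator 1 (X n ω) : ℝ≥0∞) := by
        funext m
        simp only [Function.comp_apply, hcoe]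
        rw [← ENNReal.ofReal_sum_of_nonneg fun n _ => hc0 _,
          ENNReal.toReal_ofReal (Finset.sum_nonneg fun n _ => hc0 _)]
      rw [← h3] at h2
      exact ENNReal.tendsto_ofReal ((h2.neg.mul_const _).rexp)
  have hval : ∫⁻ ω, ENNReal.ofReal (Real.exp (-(pointCount X A ω).toReal * Real.log 2)) ∂P =
      ENNReal.ofReal (Real.exp (-((ν A).toReal / 2))) := by
    rw [lintegral_comp_pointCount h.poisson hA hfin
      (f := fun y => ENNReal.ofReal (Real.exp (-y.toReal * Real.log 2))) (by fun_prop)]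
    have := lintegral_pow_inv_two_poissonMeasure (ν A).toNNReal
    rw [ENNReal.coe_toNNReal_eq_toReal] at this
    rw [← this]
    refine lintegral_congr fun k => ?_
    rw [ENNReal.toReal_natCast, neg_mul, Real.exp_neg, Real.exp_nat_mul,
      Real.exp_log (by norm_num), ENNReal.ofReal_inv_of_pos (by positivity),
      ENNReal.ofReal_pow (by norm_num), ← ENNReal.inv_pow]
    simp
  have hfinal := le_of_tendsto_of_tendsto' tendsto_const_nhds
    (ENNReal.Tendsto.const_mul hlim (Or.inr ENNReal.ofReal_ne_top)) hmarkov
  refine hfinal.trans (le_of_eq ?_)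
  rw [hval, ← ENNReal.ofReal_mul (Real.exp_pos _).le, ← Real.exp_add, sub_eq_add_neg]

end IsExpMarkedPoisson

/-! ### The law of large numbers for marked sums over growing networks -/

/-- For k² ≤ l ≤ (k+1)², monotonicity puts u(l)/l between u(k²)/(k+1)² and u((k+1)²)/k², and (k+1)/k
→ 1. Squares are sparse enough for 1/l to be summable along them, yet consecutive ones have ratio
tending to 1. -/
lemma tendsto_div_of_monotone_of_tendsto_sq {u : ℝ → ℝ} (hu : Monotone u) (h0 : ∀ x, 0 ≤ u x)
    {m : ℝ} (h : Tendsto (fun k : ℕ => u ((k : ℝ) ^ 2) / (k : ℝ) ^ 2) atTop (𝓝 m)) :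
    Tendsto (fun l => u l / l) atTop (𝓝 m) := by
  have hinv : Tendsto (fun k : ℕ => (1 : ℝ) / k) atTop (𝓝 0) := tendsto_one_div_atTop_nhds_zero_nat
  have hr : Tendsto (fun k : ℕ => ((k : ℝ) + 1) / k) atTop (𝓝 1) := by
    have : Tendsto (fun k : ℕ => (1 : ℝ) + 1 / k) atTop (𝓝 (1 + 0)) := hinv.const_add 1
    rw [add_zero] at this
    refine this.congr' ?_
    filter_upwards [eventually_gt_atTop 0] with k hk
    field_simp
  have hr' : Tendsto (fun k : ℕ => (k : ℝ) / (k + 1)) atTop (𝓝 1) := by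
    simpa using hr.inv₀ one_ne_zero
  have hk : Tendsto (fun l : ℝ => ⌊√l⌋₊) atTop atTop :=
    tendsto_nat_floor_atTop.comp Real.tendsto_sqrt_atTop
  have hup : Tendsto (fun k : ℕ => u (((k + 1 : ℕ) : ℝ) ^ 2) / ((k + 1 : ℕ) : ℝ) ^ 2 *
      (((k : ℝ) + 1) / k) ^ 2) atTop (𝓝 m) := by
    simpa using (h.comp (tendsto_add_atTop_nat 1)).mul (hr.pow 2)
  have hlo : Tendsto (fun k : ℕ => u ((k : ℝ) ^ 2) / (k : ℝ) ^ 2 *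
      ((k : ℝ) / (k + 1)) ^ 2) atTop (𝓝 m) := by
    simpa using h.mul (hr'.pow 2)
  refine tendsto_of_tendsto_of_tendsto_of_le_of_le' (hlo.comp hk) (hup.comp hk) ?_ ?_
  all_goals
    filter_upwards [eventually_ge_atTop 1] with l hl
    have hs : 1 ≤ √l := Real.one_le_sqrt.2 hl
    have hk1 : 1 ≤ ⌊√l⌋₊ := (Nat.one_le_floor_iff _).2 hs
    have h1 : (⌊√l⌋₊ : ℝ) ≤ √l := Nat.floor_le (by positivity)
    have h2 : √l < ⌊√l⌋₊ + 1 := Nat.lt_floor_add_one _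
    have h3 : √l ^ 2 = l := Real.sq_sqrt (by linarith)
    simp only [Function.comp_apply]
    generalize ⌊√l⌋₊ = k at *
    have hk0 : (0 : ℝ) < k := by exact_mod_cast hk1
    have h4 : (k : ℝ) ^ 2 ≤ l := by rw [← h3]; gcongr
    have h5 : l ≤ ((k : ℝ) + 1) ^ 2 := by rw [← h3]; gcongr
  · have e : u ((k : ℝ) ^ 2) / (k : ℝ) ^ 2 * ((k : ℝ) / (k + 1)) ^ 2 =
        u ((k : ℝ) ^ 2) / ((k : ℝ) + 1) ^ 2 := by field_simp
    rw [e]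
    exact div_le_div₀ (h0 _) (hu h4) (by linarith) h5
  · have e : u (((k + 1 : ℕ) : ℝ) ^ 2) / ((k + 1 : ℕ) : ℝ) ^ 2 * (((k : ℝ) + 1) / k) ^ 2 =
        u (((k : ℝ) + 1) ^ 2) / (k : ℝ) ^ 2 := by push_cast; field_simp
    rw [e]
    exact div_le_div₀ (h0 _) (hu h5) (by positivity) h4

/-- The plane in which the stations are located. -/
abbrev Plane : Type := EuclideanSpace ℝ (Fin 2)

/-- Unit intensity on `ℝ² × (0, ∞)`. -/
def stationIntensity : Measure (Plane × ℝ) := volume.prod (volume.restrict (Ioi (0 : ℝ)))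

instance : SigmaFinite stationIntensity := by unfold stationIntensity; infer_instance

/-- The function `f` of the position, restricted to the stations active at density `l`. -/
def activeAt (f : Plane → ℝ≥0∞) (l : ℝ) (p : Plane × ℝ) : ℝ≥0∞ := f p.1 * (Iic l).indicator 1 p.2

lemma measurable_activeAt {f : Plane → ℝ≥0∞} (hf : Measurable f) (l : ℝ) :
    Measurable (activeAt f l) :=
  (hf.comp measurable_fst).mul ((measurable_const.indicator measurableSet_Iic).comp measurable_snd)

lemma activeAt_sq (f : Plane → ℝ≥0∞) (l : ℝ) (p : Plane × ℝ) :
    activeAt f l p ^ 2 = activeAt (fun x => f x ^ 2) l p := by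
  unfold activeAt
  by_cases hp : p.2 ∈ Iic l <;> simp [hp]

lemma activeAt_mono (f : Plane → ℝ≥0∞) {l l' : ℝ} (h : l ≤ l') : activeAt f l ≤ activeAt f l' := by
  intro p
  unfold activeAt
  gcongr

lemma lintegral_activeAt {f : Plane → ℝ≥0∞} (hf : Measurable f) (l : ℝ) :
    ∫⁻ p, activeAt f l p ∂stationIntensity = (∫⁻ x, f x) * ENNReal.ofReal l := by
  unfold activeAt stationIntensity
  rw [lintegral_prod_mul (f := f) (g := (Iic l).indicator 1) hf.aemeasurable
    (measurable_const.indicator measurableSet_Iic).aemeasurable]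
  congr 1
  rw [lintegral_indicator_one measurableSet_Iic, Measure.restrict_apply measurableSet_Iic,
    inter_comm, Ioi_inter_Iic, Real.volume_Ioc, sub_zero]

section LLN

variable {Ω : Type*} [MeasurableSpace Ω] {P : Measure Ω} [IsProbabilityMeasure P]
  {X : ℕ → Ω → Plane × ℝ} {g : ℕ → Ω → ℝ}

/-- The strong law of large numbers for marked sums over the network, as its density grows. -/
lemma IsExpMarkedPoisson.tendsto_markedSum_div (h : IsExpMarkedPoisson X g stationIntensity P)
    {f : Plane → ℝ≥0∞} (hf : Measurable f) (hfin : ∫⁻ x, f x ≠ ∞) (hfin2 : ∫⁻ x, f x ^ 2 ≠ ∞) :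
    ∀ᵐ ω ∂P, (∀ l, markedSum X g (activeAt f l) ω ≠ ∞) ∧
      Tendsto (fun l => (markedSum X g (activeAt f l) ω).toReal / l) atTop
        (𝓝 (∫⁻ x, f x).toReal) := by
  set m := (∫⁻ x, f x).toReal with hm
  have hmeas : ∀ l, AEMeasurable (markedSum X g (activeAt f l)) P :=
    fun l => h.aemeasurable_markedSum (measurable_activeAt hf l)
  have hlfin : ∀ l, ∫⁻ p, activeAt f l p ∂stationIntensity ≠ ∞ := fun l => by
    rw [lintegral_activeAt hf]; exact ENNReal.mul_ne_top hfin ENNReal.ofReal_ne_top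
  have hlt : ∀ᵐ ω ∂P, ∀ k : ℕ, markedSum X g (activeAt f k) ω < ∞ :=
    ae_all_iff.2 fun k => ae_lt_top' (hmeas k) (by
      rw [h.lintegral_markedSum (measurable_activeAt hf _)]; exact hlfin _)
  let Z : ℕ → Ω → ℝ≥0∞ := fun k ω => ENNReal.ofReal
    (((markedSum X g (activeAt f (((k + 1 : ℕ) : ℝ) ^ 2)) ω).toReal /
      ((k + 1 : ℕ) : ℝ) ^ 2 - m) ^ 2)
  have hZm : ∀ k, AEMeasurable (Z k) P := fun k =>
    ((((hmeas _).ennreal_toReal.div_const _).sub_const _).pow_const 2).ennreal_ofReal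
  -- The variance is 2l ∫ f², so dividing by l² leaves a multiple of 1/l. The index shift in `Z`
  -- keeps l positive.
  have hZ : ∀ k, ∫⁻ ω, Z k ω ∂P =
      2 * (∫⁻ x, f x ^ 2) * ENNReal.ofReal (1 / ((k + 1 : ℕ) : ℝ) ^ 2) := by
    intro k
    set l : ℝ := ((k + 1 : ℕ) : ℝ) ^ 2 with hl
    have hl0 : 0 < l := by positivity
    have hv := h.lintegral_markedSum_sub_sq (measurable_activeAt hf l) (hlfin l)
    simp_rw [activeAt_sq] at hv
    rw [lintegral_activeAt hf, lintegral_activeAt (hf.pow_const 2), ENNReal.toReal_mul,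
      ENNReal.toReal_ofReal hl0.le, ← hm] at hv
    have hpt : ∀ ω, Z k ω = ENNReal.ofReal (1 / l ^ 2) *
        ENNReal.ofReal (((markedSum X g (activeAt f l) ω).toReal - m * l) ^ 2) := by
      intro ω
      rw [← ENNReal.ofReal_mul (by positivity)]
      simp only [Z, ← hl]
      congr 1
      field_simp
    simp_rw [hpt]
    rw [lintegral_const_mul' _ _ ENNReal.ofReal_ne_top, hv]
    have : ENNReal.ofReal (1 / l) = ENNReal.ofReal (1 / l ^ 2) * ENNReal.ofReal l := by
      rw [← ENNReal.ofReal_mul (by positivity)]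
      congr 1
      field_simp
    rw [this]
    ring
  have hsum : ∑' k, ∫⁻ ω, Z k ω ∂P ≠ ∞ := by
    simp_rw [hZ]
    rw [ENNReal.tsum_mul_left]
    refine ENNReal.mul_ne_top (ENNReal.mul_ne_top (by norm_num) hfin2) ?_
    have hs : Summable fun k : ℕ => 1 / ((k + 1 : ℕ) : ℝ) ^ 2 :=
      (summable_nat_add_iff 1).2 (Real.summable_one_div_nat_pow.2 one_lt_two)
    rw [← ENNReal.ofReal_tsum_of_nonneg (fun k => by positivity) hs]
    exact ENNReal.ofReal_ne_top
  -- A sum with finite expectation converges almost surely, so its terms, the squared deviations,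
  -- tend to 0.
  have hae : ∀ᵐ ω ∂P, ∑' k, Z k ω < ∞ :=
    ae_lt_top' (AEMeasurable.tsum hZm) (by rwa [lintegral_tsum hZm])
  filter_upwards [hlt, hae] with ω hω1 hω2
  -- Monotonicity in l extends finiteness from integer densities, where a countable union of null
  -- sets suffices, to all densities.
  have hfinω : ∀ l, markedSum X g (activeAt f l) ω ≠ ∞ := fun l => by
    obtain ⟨k, hk⟩ := exists_nat_ge l
    exact ((markedSum_mono (activeAt_mono f hk) ω).trans_lt (hω1 k)).ne
  refine ⟨hfinω, tendsto_div_of_monotone_of_tendsto_sq ?_ (fun _ => ENNReal.toReal_nonneg) ?_⟩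
  · exact fun l l' hll => ENNReal.toReal_mono (hfinω l') (markedSum_mono (activeAt_mono f hll) ω)
  · rw [← tendsto_add_atTop_iff_nat 1]
    have h1 := ENNReal.tendsto_atTop_zero_of_tsum_ne_top hω2.ne
    have h2 := (ENNReal.tendsto_toReal ENNReal.zero_ne_top).comp h1
    have h3 : ENNReal.toReal ∘ (fun k => Z k ω) = fun k : ℕ =>
        ((markedSum X g (activeAt f (((k + 1 : ℕ) : ℝ) ^ 2)) ω).toReal /
          ((k + 1 : ℕ) : ℝ) ^ 2 - m) ^ 2 := by
      funext k
      simp only [Function.comp_apply, Z]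
      rw [ENNReal.toReal_ofReal (sq_nonneg _)]
    rw [h3, ENNReal.toReal_zero] at h2
    have h4 := h2.sqrt
    simp only [Real.sqrt_sq_eq_abs, Real.sqrt_zero] at h4
    have h5 := (tendsto_zero_iff_abs_tendsto_zero _).2 h4
    simpa using h5.add_const m

end LLN

/-! ### Gain, serving distance and interference -/

/-- The path gain as a function of the position. -/
def planarGain (L : ℝ → ℝ) (x : Plane) : ℝ≥0∞ := ENNReal.ofReal (L ‖x‖)

/-- The total path gain `∫ L(‖x‖) dx` over the plane. -/
def totalGain (L : ℝ → ℝ) : ℝ := (∫⁻ x, planarGain L x).toReal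

namespace PhysicallyFeasible

variable {L : ℝ → ℝ}

lemma measurable_planarGain (hL : PhysicallyFeasible L) : Measurable (planarGain L) :=
  (hL.measurable.comp measurable_norm).ennreal_ofReal

/-- Polar coordinates in the plane turn the integral into a positive multiple of ∫ r L(r) dr. -/
lemma lintegral_planarGain (hL : PhysicallyFeasible L) :
    ∫⁻ x, planarGain L x ≠ ∞ ∧ 0 < totalGain L := by
  have hint : Integrable (fun x : Plane => L ‖x‖) := by
    rw [integrable_fun_norm_addHaar (volume : Measure Plane)]
    simpa using hL.integrable
  have hval := integral_fun_norm_addHaar (volume : Measure Plane) L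
  simp only [finrank_euclideanSpace, Fintype.card_fin, smul_eq_mul, Nat.add_one_sub_one,
    pow_one] at hval
  have hnn : 0 ≤ᵐ[volume] fun x : Plane => L ‖x‖ :=
    Eventually.of_forall fun x => hL.nonneg _ (norm_nonneg x)
  have heq : ∫⁻ x, planarGain L x = ENNReal.ofReal (∫ x : Plane, L ‖x‖) :=
    (ofReal_integral_eq_lintegral_ofReal hint hnn).symm
  refine ⟨heq ▸ ENNReal.ofReal_ne_top, ?_⟩
  have hball : 0 < (volume : Measure Plane).real (Metric.ball 0 1) :=
    ENNReal.toReal_pos (Metric.measure_ball_pos _ _ one_pos).ne' measure_ball_lt_top.ne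
  have hpos : 0 < ∫ x : Plane, L ‖x‖ := by
    rw [hval]
    exact nsmul_pos (mul_pos hball hL.integral_pos) (by norm_num)
  rw [totalGain, heq, ENNReal.toReal_ofReal hpos.le]
  exact hpos

lemma lintegral_planarGain_sq (hL : PhysicallyFeasible L) : ∫⁻ x, planarGain L x ^ 2 ≠ ∞ := by
  have h1 : ∀ x, planarGain L x ^ 2 ≤ ENNReal.ofReal (L 0) * planarGain L x := fun x => by
    rw [pow_two]
    exact mul_le_mul_left (ENNReal.ofReal_le_ofReal (hL.le_zero _ (norm_nonneg x))) _
  refine ((lintegral_mono h1).trans_lt ?_).ne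
  rw [lintegral_const_mul' _ _ ENNReal.ofReal_ne_top]
  exact ENNReal.mul_lt_top ENNReal.ofReal_lt_top hL.lintegral_planarGain.1.lt_top

end PhysicallyFeasible

lemma IsMISOModel.isExpMarkedPoisson {Ω : Type*} [MeasurableSpace Ω] {P : Measure Ω}
    {X : ℕ → Ω → Plane × ℝ} {g : ℕ → Ω → ℝ} {h : ℕ → Ω → ℂ} (hm : IsMISOModel X g h P) :
    IsExpMarkedPoisson X g stationIntensity P where
  poisson := hm.poisson
  law := hm.fading_law
  indep := hm.fading_indep
  indep_points := hm.indep_locations.comp measurable_id measurable_fst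

section Geometry

variable {Ω : Type*} {X : ℕ → Ω → Plane × ℝ} {g : ℕ → Ω → ℝ} {L : ℝ → ℝ}

lemma servingDistance_nonneg (l : ℝ) (ω : Ω) : 0 ≤ servingDistance X l ω :=
  Real.sInf_nonneg fun _ ⟨_, _, hr⟩ => hr ▸ norm_nonneg _

lemma servingDistance_le {l : ℝ} {ω : Ω} {n : ℕ} (hn : (X n ω).2 ≤ l) :
    servingDistance X l ω ≤ ‖(X n ω).1‖ :=
  csInf_le ⟨0, fun _ ⟨_, _, hr⟩ => hr ▸ norm_nonneg _⟩ ⟨n, hn, rfl⟩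

lemma measurable_servingDistance [MeasurableSpace Ω] (hX : ∀ n, Measurable (X n)) (l : ℝ) :
    Measurable (servingDistance X l) := by
  refine measurable_of_Iio fun c => ?_
  have h1 : ∀ n, MeasurableSet {ω | (X n ω).2 ≤ l} := fun n =>
    measurableSet_le (hX n).snd measurable_const
  have h2 : ∀ n, MeasurableSet {ω | ‖(X n ω).1‖ < c} := fun n =>
    measurableSet_lt (hX n).fst.norm measurable_const
  -- The first part accounts for an empty network, where the infimum of the empty set is 0.
  have : servingDistance X l ⁻¹' Iio c =
      ({_ω | 0 < c} ∩ ⋂ n, {ω | (X n ω).2 ≤ l}ᶜ) ∪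
        ⋃ n, {ω | (X n ω).2 ≤ l} ∩ {ω | ‖(X n ω).1‖ < c} := by
    ext ω
    simp only [mem_preimage, mem_Iio, mem_union, mem_inter_iff, mem_ofPred_eq, mem_iInter,
      mem_compl_iff, mem_iUnion]
    by_cases hne : ∃ n, (X n ω).2 ≤ l
    · have : ¬ ∀ n, ¬ (X n ω).2 ≤ l := by push Not; exact hne
      simp only [this, and_false, false_or]
      obtain ⟨n, hn⟩ := hne
      have hbdd : BddBelow {r : ℝ | ∃ n, (X n ω).2 ≤ l ∧ r = ‖(X n ω).1‖} :=
        ⟨0, fun _ ⟨_, _, hr⟩ => hr ▸ norm_nonneg _⟩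
      refine (csInf_lt_iff hbdd ⟨_, n, hn, rfl⟩).trans ?_
      constructor
      · rintro ⟨r, ⟨k, hk, rfl⟩, hr⟩
        exact ⟨k, hk, hr⟩
      · rintro ⟨k, hk, hr⟩
        exact ⟨_, ⟨k, hk, rfl⟩, hr⟩
    · push Not at hne
      have hemp : {r : ℝ | ∃ n, (X n ω).2 ≤ l ∧ r = ‖(X n ω).1‖} = ∅ := by
        ext r
        simp only [mem_ofPred_eq, mem_empty_iff_false, iff_false, not_exists, not_and]
        exact fun n hn => absurd hn (not_le.2 (hne n))
      have : servingDistance X l ω = 0 := by rw [servingDistance, hemp, Real.sInf_empty]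
      rw [this]
      constructor
      · exact fun h => Or.inl ⟨h, fun n => not_le.2 (hne n)⟩
      · rintro (h | ⟨n, hn, _⟩)
        · exact h.1
        · exact absurd hn (not_le.2 (hne n))
  rw [this]
  exact ((MeasurableSet.const _).inter (MeasurableSet.iInter fun n => (h1 n).compl)).union
    (MeasurableSet.iUnion fun n => (h1 n).inter (h2 n))

lemma aemeasurable_interference [MeasurableSpace Ω] {P : Measure Ω} (hX : ∀ n, Measurable (X n))
    (hg : ∀ n, AEMeasurable (g n) P) (hL : Measurable L) (l : ℝ) :
    AEMeasurable (interference L X g l) P := by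
  refine AEMeasurable.tsum fun n => ?_
  have hs : MeasurableSet {ω | (X n ω).2 ≤ l ∧ servingDistance X l ω < ‖(X n ω).1‖} :=
    (measurableSet_le (hX n).snd measurable_const).inter
      (measurableSet_lt (measurable_servingDistance hX l) (hX n).fst.norm)
  have hf : AEMeasurable (fun ω => ENNReal.ofReal (L ‖(X n ω).1‖ * g n ω)) P :=
    ((hL.comp (hX n).fst.norm).aemeasurable.mul (hg n)).ennreal_ofReal
  refine (hf.indicator hs).congr (Eventually.of_forall fun ω => ?_)
  simp only [indicator_apply, mem_ofPred_eq]

lemma interference_le_markedSum (hL : PhysicallyFeasible L) (l : ℝ) (ω : Ω) :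
    interference L X g l ω ≤ markedSum X g (activeAt (planarGain L) l) ω := by
  refine ENNReal.tsum_le_tsum fun n => ?_
  split_ifs with hn
  · rw [ENNReal.ofReal_mul (hL.nonneg _ (norm_nonneg _))]
    simp [activeAt, planarGain, hn.1]
  · exact zero_le

/-- Once the serving station is within ε, every active station beyond ε interferes. This replaces
the random exclusion radius by a fixed one and leaves a genuine marked Poisson sum. -/
lemma markedSum_le_interference (hL : PhysicallyFeasible L) {l ε : ℝ} {ω : Ω}
    (hε : servingDistance X l ω ≤ ε) :
    markedSum X g (activeAt ({x | ε < ‖x‖}.indicator (planarGain L)) l) ω ≤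
      interference L X g l ω := by
  refine ENNReal.tsum_le_tsum fun n => ?_
  by_cases h1 : (X n ω).2 ≤ l
  · by_cases h2 : ε < ‖(X n ω).1‖
    · rw [if_pos ⟨h1, hε.trans_lt h2⟩, ENNReal.ofReal_mul (hL.nonneg _ (norm_nonneg _))]
      simp [activeAt, planarGain, h1, h2]
    · simp [activeAt, h2]
  · simp [activeAt, h1]

lemma markedSum_eq_zero_of_lt_servingDistance {l ε : ℝ} {ω : Ω}
    (hε : ε < servingDistance X l ω) :
    markedSum X g (activeAt ((Metric.closedBall 0 ε).indicator 1) l) ω = 0 := by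
  refine ENNReal.tsum_eq_zero.2 fun n => ?_
  by_cases h1 : (X n ω).2 ≤ l
  · have h2 : (X n ω).1 ∉ Metric.closedBall (0 : Plane) ε := by
      rw [mem_closedBall_zero_iff]
      exact not_le.2 (hε.trans_le (servingDistance_le h1))
    simp [activeAt, h2]
  · simp [activeAt, h1]

lemma activeAt_indicator (B : Set Plane) (l : ℝ) :
    activeAt (B.indicator 1) l = (B ×ˢ Iic l).indicator 1 := by
  funext p
  unfold activeAt
  by_cases h1 : p.1 ∈ B <;> by_cases h2 : p.2 ≤ l <;> simp [h1, h2, mem_prod]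

end Geometry

/-! ### Almost sure asymptotics and lower tail of the interference -/

section AlmostSure

variable {Ω : Type*} [MeasurableSpace Ω] {P : Measure Ω} [IsProbabilityMeasure P]
  {X : ℕ → Ω → Plane × ℝ} {g : ℕ → Ω → ℝ} {L : ℝ → ℝ}

/-- The law of large numbers for the indicator of a small ball has a positive limit, so the marked
sum over the ball is eventually nonzero, which is impossible while the serving distance exceeds the
radius. -/
lemma IsExpMarkedPoisson.tendsto_servingDistance (h : IsExpMarkedPoisson X g stationIntensity P) :
    ∀ᵐ ω ∂P, Tendsto (fun l => servingDistance X l ω) atTop (𝓝 0) := by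
  have hk : ∀ k : ℕ, ∀ᵐ ω ∂P, ∀ᶠ l in atTop, servingDistance X l ω ≤ 1 / ((k : ℝ) + 1) := by
    intro k
    set ε : ℝ := 1 / ((k : ℝ) + 1)
    have hε : 0 < ε := by positivity
    have hmeas : Measurable ((Metric.closedBall (0 : Plane) ε).indicator (1 : Plane → ℝ≥0∞)) :=
      measurable_const.indicator Metric.isClosed_closedBall.measurableSet
    have hint : ∫⁻ x, (Metric.closedBall (0 : Plane) ε).indicator 1 x =
        volume (Metric.closedBall (0 : Plane) ε) :=
      lintegral_indicator_one Metric.isClosed_closedBall.measurableSet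
    have hfin : volume (Metric.closedBall (0 : Plane) ε) ≠ ∞ := measure_closedBall_lt_top.ne
    have hsq : ∀ x, (Metric.closedBall (0 : Plane) ε).indicator (1 : Plane → ℝ≥0∞) x ^ 2 =
        (Metric.closedBall (0 : Plane) ε).indicator 1 x := fun x => by
      by_cases hx : x ∈ Metric.closedBall (0 : Plane) ε <;> simp [hx]
    filter_upwards [h.tendsto_markedSum_div hmeas (hint ▸ hfin)
      (by simp_rw [hsq]; exact hint ▸ hfin)]
      with ω hω
    have hpos : 0 < (∫⁻ x, (Metric.closedBall (0 : Plane) ε).indicator 1 x).toReal := by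
      rw [hint]
      exact ENNReal.toReal_pos (Metric.measure_closedBall_pos _ _ hε).ne' hfin
    filter_upwards [hω.2.eventually (lt_mem_nhds hpos)] with l hl
    by_contra hcon
    rw [markedSum_eq_zero_of_lt_servingDistance (not_le.1 hcon)] at hl
    simp at hl
  filter_upwards [ae_all_iff.2 hk] with ω hω
  refine tendsto_order.2 ⟨fun a ha => Eventually.of_forall fun l =>
    ha.trans_le (servingDistance_nonneg l ω), fun a ha => ?_⟩
  obtain ⟨k, hka⟩ := exists_nat_one_div_lt ha
  filter_upwards [hω k] with l hl using hl.trans_lt hka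

/-- The interference lies between the marked sums over all stations and over those beyond 1/(k+1).
Both obey the law of large numbers, and the lower limit tends to the total gain as k grows because
the origin is a null set. -/
lemma IsExpMarkedPoisson.tendsto_interference_div (h : IsExpMarkedPoisson X g stationIntensity P)
    (hL : PhysicallyFeasible L) :
    ∀ᵐ ω ∂P, (∀ l, interference L X g l ω ≠ ∞) ∧
      Tendsto (fun l => (interference L X g l ω).toReal / l) atTop (𝓝 (totalGain L)) := by
  let f : ℕ → Plane → ℝ≥0∞ := fun k => {x | 1 / ((k : ℝ) + 1) < ‖x‖}.indicator (planarGain L)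
  have hset : ∀ k : ℕ, MeasurableSet {x : Plane | 1 / ((k : ℝ) + 1) < ‖x‖} := fun k =>
    measurableSet_lt measurable_const measurable_norm
  have hfm : ∀ k, Measurable (f k) := fun k => hL.measurable_planarGain.indicator (hset k)
  have hfle : ∀ k x, f k x ≤ planarGain L x := fun k x => indicator_le_self _ _ x
  have hfin : ∀ k, ∫⁻ x, f k x ≠ ∞ := fun k =>
    ((lintegral_mono (hfle k)).trans_lt hL.lintegral_planarGain.1.lt_top).ne
  have hfin2 : ∀ k, ∫⁻ x, f k x ^ 2 ≠ ∞ := fun k =>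
    ((lintegral_mono fun x => pow_le_pow_left₀ zero_le (hfle k x) 2).trans_lt
      hL.lintegral_planarGain_sq.lt_top).ne
  have hlim : Tendsto (fun k => (∫⁻ x, f k x).toReal) atTop (𝓝 (totalGain L)) := by
    refine (ENNReal.tendsto_toReal hL.lintegral_planarGain.1).comp ?_
    refine tendsto_lintegral_of_dominated_convergence (planarGain L) hfm
      (fun k => Eventually.of_forall (hfle k)) hL.lintegral_planarGain.1 ?_
    have h0 : ∀ᵐ x : Plane, x ≠ 0 := by simp [ae_iff]
    filter_upwards [h0] with x hx
    obtain ⟨k, hk⟩ := exists_nat_one_div_lt (norm_pos_iff.2 hx)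
    refine tendsto_const_nhds.congr' ?_
    filter_upwards [eventually_ge_atTop k] with j hj
    have : 1 / ((j : ℝ) + 1) < ‖x‖ := (Nat.one_div_le_one_div hj).trans_lt hk
    exact (indicator_of_mem (s := {x : Plane | 1 / ((j : ℝ) + 1) < ‖x‖}) this _).symm
  filter_upwards [h.tendsto_markedSum_div hL.measurable_planarGain hL.lintegral_planarGain.1
      hL.lintegral_planarGain_sq, h.tendsto_servingDistance,
      ae_all_iff.2 fun k => h.tendsto_markedSum_div (hfm k) (hfin k) (hfin2 k)] with ω h1 h2 h3
  have hI : ∀ l, interference L X g l ω ≠ ∞ := fun l =>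
    ((interference_le_markedSum hL l ω).trans_lt (h1.1 l).lt_top).ne
  refine ⟨hI, tendsto_order.2 ⟨fun a ha => ?_, fun a ha => ?_⟩⟩
  · obtain ⟨k, hk⟩ := (hlim.eventually (lt_mem_nhds ha)).exists
    filter_upwards [(h3 k).2.eventually (lt_mem_nhds hk), eventually_gt_atTop 0,
      h2.eventually (gt_mem_nhds (show (0 : ℝ) < 1 / ((k : ℝ) + 1) by positivity))] with l hl hl0 hd
    refine hl.trans_le ?_
    gcongr
    · exact hI l
    · exact markedSum_le_interference hL hd.le
  · filter_upwards [h1.2.eventually (gt_mem_nhds ha), eventually_gt_atTop 0] with l hl hl0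
    refine lt_of_le_of_lt ?_ hl
    gcongr
    · exact h1.1 l
    · exact interference_le_markedSum hL l ω

/-- The interference is at least linear in the density, except on an event of exponentially
small probability. -/
lemma IsExpMarkedPoisson.measure_interference_lt_le
    (h : IsExpMarkedPoisson X g stationIntensity P) (hL : PhysicallyFeasible L) :
    ∃ δ c : ℝ, 0 < δ ∧ 0 < c ∧ ∀ l, 0 < l →
      P.real {ω | interference L X g l ω < ENNReal.ofReal (δ * l)} ≤ 2 * Real.exp (-(c * l)) := by
  -- A region away from the origin with gain bounded below. Some `B k` has positive volume, since
  -- otherwise the gain would vanish almost everywhere; its volume is finite by Markov's inequality.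
  let B : ℕ → Set Plane := fun k =>
    {x | 1 / ((k : ℝ) + 1) < ‖x‖} ∩ {x | ENNReal.ofReal (1 / ((k : ℝ) + 1)) ≤ planarGain L x}
  have hBm : ∀ k, MeasurableSet (B k) := fun k =>
    (measurableSet_lt measurable_const measurable_norm).inter
      (measurableSet_le measurable_const hL.measurable_planarGain)
  obtain ⟨k, hk⟩ : ∃ k, volume (B k) ≠ 0 := by
    by_contra! hcon
    have h1 : ∀ᵐ x : Plane, ∀ k, x ∉ B k := ae_all_iff.2 fun k => by
      simpa [ae_iff] using hcon k
    have h0 : ∀ᵐ x : Plane, x ≠ 0 := by simp [ae_iff]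
    have h2 : planarGain L =ᵐ[volume] 0 := by
      filter_upwards [h1, h0] with x hx hx0
      by_contra hne
      have hpos : 0 < L ‖x‖ := ENNReal.ofReal_pos.1 (pos_iff_ne_zero.2 hne)
      obtain ⟨k, hk⟩ := exists_nat_one_div_lt (lt_min hpos (norm_pos_iff.2 hx0))
      exact hx k ⟨hk.trans_le (min_le_right _ _),
        ENNReal.ofReal_le_ofReal (hk.le.trans (min_le_left _ _))⟩
    have h3 := hL.lintegral_planarGain.2
    rw [totalGain, lintegral_congr_ae h2] at h3
    simp at h3
  set η : ℝ := 1 / ((k : ℝ) + 1) with hη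
  have hη0 : 0 < η := by positivity
  have hBfin : volume (B k) ≠ ∞ := by
    have h1 := meas_ge_le_lintegral_div hL.measurable_planarGain.aemeasurable (μ := volume)
      (ENNReal.ofReal_pos.2 hη0).ne' ENNReal.ofReal_ne_top
    refine ((measure_mono inter_subset_right).trans_lt (h1.trans_lt ?_)).ne
    exact ENNReal.div_lt_top hL.lintegral_planarGain.1 (ENNReal.ofReal_pos.2 hη0).ne'
  set b := (volume (B k)).toReal with hb
  have hb0 : 0 < b := ENNReal.toReal_pos hk hBfin
  set b' := (volume (Metric.closedBall (0 : Plane) η)).toReal with hb'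
  have hb'0 : 0 < b' := ENNReal.toReal_pos (Metric.measure_closedBall_pos _ _ hη0).ne'
    measure_closedBall_lt_top.ne
  -- The level is half of the Chernoff exponent |A|l/2, so |A|l/4 is left over as the rate.
  have htail : ∀ (A : Set Plane), MeasurableSet A → volume A ≠ ∞ → ∀ l, 0 < l →
      P {ω | markedSum X g (activeAt (A.indicator 1) l) ω <
        ENNReal.ofReal ((volume A).toReal / 4 * l)} ≤
        ENNReal.ofReal (Real.exp (-((volume A).toReal / 4 * l))) := by
    intro A hA hAfin l hl
    have hAl : stationIntensity (A ×ˢ Iic l) = volume A * ENNReal.ofReal l := by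
      rw [← lintegral_indicator_one (hA.prod measurableSet_Iic), ← activeAt_indicator,
        lintegral_activeAt (measurable_one.indicator hA), lintegral_indicator_one hA]
    have := h.measure_markedSum_lt_le (hA.prod (measurableSet_Iic (a := l)))
      (hAl ▸ ENNReal.mul_ne_top hAfin ENNReal.ofReal_ne_top) ((volume A).toReal / 4 * l)
    rw [hAl, ENNReal.toReal_mul, ENNReal.toReal_ofReal hl.le] at this
    rw [activeAt_indicator]
    refine this.trans (le_of_eq ?_)
    congr 2
    ring
  refine ⟨η * (b / 4), min b b' / 4, by positivity, by positivity, fun l hl => ?_⟩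
  -- Either no active station is within η, and the marked sum over the ball is 0, or all active
  -- stations in `B k` interfere with gain at least η, and their marks must be small.
  have hsub : {ω | interference L X g l ω < ENNReal.ofReal (η * (b / 4) * l)} ⊆
      {ω | markedSum X g (activeAt ((Metric.closedBall 0 η).indicator 1) l) ω <
        ENNReal.ofReal (b' / 4 * l)} ∪
      {ω | markedSum X g (activeAt ((B k).indicator 1) l) ω < ENNReal.ofReal (b / 4 * l)} := by
    intro ω hω
    rcases lt_or_ge η (servingDistance X l ω) with hd | hd
    · left
      rw [mem_ofPred_eq, markedSum_eq_zero_of_lt_servingDistance hd]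
      exact ENNReal.ofReal_pos.2 (by positivity)
    · right
      have h1 : ENNReal.ofReal η * markedSum X g (activeAt ((B k).indicator 1) l) ω ≤
          interference L X g l ω := by
        refine le_trans ?_ (markedSum_le_interference hL hd)
        unfold markedSum
        rw [← ENNReal.tsum_mul_left]
        refine ENNReal.tsum_le_tsum fun n => ?_
        rw [← mul_assoc]
        refine mul_le_mul_left ?_ _
        unfold activeAt
        rw [← mul_assoc]
        refine mul_le_mul_left ?_ _
        by_cases hx : (X n ω).1 ∈ B k
        · have h3 : (X n ω).1 ∈ {x : Plane | η < ‖x‖} := hx.1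
          rw [indicator_of_mem hx, indicator_of_mem h3, Pi.one_apply, mul_one]
          exact hx.2
        · simp [hx]
      have h2 := h1.trans_lt hω
      rw [mul_assoc, ENNReal.ofReal_mul hη0.le] at h2
      exact lt_of_mul_lt_mul_left' h2
  have hle : P {ω | interference L X g l ω < ENNReal.ofReal (η * (b / 4) * l)} ≤
      ENNReal.ofReal (2 * Real.exp (-(min b b' / 4 * l))) := by
    refine (measure_mono hsub).trans ((measure_union_le _ _).trans ?_)
    rw [two_mul, ENNReal.ofReal_add (Real.exp_pos _).le (Real.exp_pos _).le]
    refine add_le_add ((htail _ Metric.isClosed_closedBall.measurableSet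
      measure_closedBall_lt_top.ne l hl).trans ?_) ((htail _ (hBm k) hBfin l hl).trans ?_)
    · refine ENNReal.ofReal_le_ofReal (Real.exp_le_exp.2 (neg_le_neg ?_))
      gcongr
      exact min_le_right _ _
    · refine ENNReal.ofReal_le_ofReal (Real.exp_le_exp.2 (neg_le_neg ?_))
      gcongr
      exact min_le_left _ _
  exact ENNReal.toReal_le_of_le_ofReal (by positivity) hle

end AlmostSure

/-! ### The beamforming gain -/

lemma integral_sq_gaussianReal (v : ℝ≥0) : ∫ x, x ^ 2 ∂(gaussianReal 0 v) = v := by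
  have h := variance_fun_id_gaussianReal (μ := 0) (v := v)
  rwa [variance_of_integral_eq_zero (by fun_prop) (by simp)] at h

lemma memLp_sq_gaussianReal (v : ℝ≥0) : MemLp (fun x : ℝ => x ^ 2) 2 (gaussianReal 0 v) := by
  rw [memLp_two_iff_integrable_sq (by fun_prop)]
  have := (memLp_id_gaussianReal (μ := 0) (v := v) 4).integrable_norm_pow (p := 4) (by norm_num)
  refine this.congr (Eventually.of_forall fun x => ?_)
  simp only [id, Real.norm_eq_abs]
  rw [← pow_mul, Even.pow_abs (by decide)]

lemma measurable_norm_sq_complex : Measurable fun z : ℂ => ‖z‖ ^ 2 := by fun_prop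

lemma norm_sq_measurableEquivRealProd_symm (p : ℝ × ℝ) :
    ‖Complex.measurableEquivRealProd.symm p‖ ^ 2 = p.1 ^ 2 + p.2 ^ 2 := by
  rw [Complex.sq_norm, Complex.normSq_apply]
  simp only [pow_two]
  rfl

lemma memLp_norm_sq_stdComplexGaussian :
    MemLp (fun z : ℂ => ‖z‖ ^ 2) 2 stdComplexGaussian := by
  rw [stdComplexGaussian, memLp_map_measure_iff (by fun_prop) (by fun_prop)]
  have := ((memLp_sq_gaussianReal (1 / 2)).comp_fst (gaussianReal 0 (1 / 2))).add
    ((memLp_sq_gaussianReal (1 / 2)).comp_snd (gaussianReal 0 (1 / 2)))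
  refine this.ae_eq (Eventually.of_forall fun p => ?_)
  exact (norm_sq_measurableEquivRealProd_symm p).symm

lemma integral_norm_sq_stdComplexGaussian : ∫ z, ‖z‖ ^ 2 ∂stdComplexGaussian = 1 := by
  rw [stdComplexGaussian, integral_map (by fun_prop) (by fun_prop)]
  simp_rw [norm_sq_measurableEquivRealProd_symm]
  have hi := (memLp_sq_gaussianReal (1 / 2)).integrable (by norm_num)
  rw [integral_add (hi.comp_fst _) (hi.comp_snd _), integral_fun_fst (fun x : ℝ => x ^ 2),
    integral_fun_snd (fun x : ℝ => x ^ 2), integral_sq_gaussianReal]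
  norm_num

section Channel

/-- The beamforming gain with `n` antennas, divided by `n`. -/
def averageGain {Ω : Type*} (h : ℕ → Ω → ℂ) (n : ℕ) (ω : Ω) : ℝ :=
  (∑ j ∈ Finset.range n, ‖h j ω‖ ^ 2) / n

lemma averageGain_nonneg {Ω : Type*} {h : ℕ → Ω → ℂ} (n : ℕ) (ω : Ω) : 0 ≤ averageGain h n ω := by
  unfold averageGain; positivity

variable {Ω : Type*} [MeasurableSpace Ω] {P : Measure Ω} {h : ℕ → Ω → ℂ}

lemma memLp_norm_sq_channel (hlaw : ∀ j, HasLaw (h j) stdComplexGaussian P) (j : ℕ) :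
    MemLp (fun ω => ‖h j ω‖ ^ 2) 2 P := by
  have h1 : MemLp (fun z : ℂ => ‖z‖ ^ 2) 2 (P.map (h j)) := by
    rw [(hlaw j).map_eq]; exact memLp_norm_sq_stdComplexGaussian
  exact h1.comp_of_map (hlaw j).aemeasurable

lemma identDistrib_norm_sq_channel (hlaw : ∀ j, HasLaw (h j) stdComplexGaussian P) (j : ℕ) :
    IdentDistrib (fun ω => ‖h j ω‖ ^ 2) (fun ω => ‖h 0 ω‖ ^ 2) P P :=
  IdentDistrib.comp ⟨(hlaw j).aemeasurable, (hlaw 0).aemeasurable,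
    by rw [(hlaw j).map_eq, (hlaw 0).map_eq]⟩ measurable_norm_sq_complex

lemma integral_norm_sq_channel (hlaw : ∀ j, HasLaw (h j) stdComplexGaussian P) (j : ℕ) :
    ∫ ω, ‖h j ω‖ ^ 2 ∂P = 1 := by
  rw [← integral_norm_sq_stdComplexGaussian,
    ← (hlaw j).integral_comp (f := fun z : ℂ => ‖z‖ ^ 2) (by fun_prop)]
  rfl

lemma pairwise_indepFun_norm_sq_channel (hind : iIndepFun h P) :
    Pairwise (Function.onFun (fun Y Z => IndepFun Y Z P) fun j ω => ‖h j ω‖ ^ 2) :=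
  fun _ _ hij => (hind.indepFun hij).comp measurable_norm_sq_complex measurable_norm_sq_complex

lemma memLp_averageGain (hlaw : ∀ j, HasLaw (h j) stdComplexGaussian P) (n : ℕ) :
    MemLp (averageGain h n) 2 P := by
  have : MemLp (fun ω => ∑ j ∈ Finset.range n, ‖h j ω‖ ^ 2) 2 P :=
    memLp_finsetSum _ fun j _ => memLp_norm_sq_channel hlaw j
  have h2 := this.mul_const (n : ℝ)⁻¹
  simp only [← div_eq_mul_inv] at h2
  exact h2

/-- By Cauchy–Schwarz the square of an average is at most the average of the squares. The bound is
uniform in the number of antennas. -/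
lemma integral_averageGain_sq_le (hlaw : ∀ j, HasLaw (h j) stdComplexGaussian P) (n : ℕ) :
    ∫ ω, averageGain h n ω ^ 2 ∂P ≤ ∫ ω, (‖h 0 ω‖ ^ 2) ^ 2 ∂P := by
  have hsq : ∀ j, Integrable (fun ω => (‖h j ω‖ ^ 2) ^ 2) P := fun j =>
    (memLp_norm_sq_channel hlaw j).integrable_sq
  have heq : ∀ j, ∫ ω, (‖h j ω‖ ^ 2) ^ 2 ∂P = ∫ ω, (‖h 0 ω‖ ^ 2) ^ 2 ∂P := fun j =>
    ((identDistrib_norm_sq_channel hlaw j).comp (measurable_id.pow_const 2)).integral_eq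
  have hpt : ∀ ω, averageGain h n ω ^ 2 ≤ (n : ℝ)⁻¹ * ∑ j ∈ Finset.range n, (‖h j ω‖ ^ 2) ^ 2 := by
    intro ω
    have h1 := sq_sum_le_card_mul_sum_sq (s := Finset.range n) (f := fun j => ‖h j ω‖ ^ 2)
    rw [Finset.card_range] at h1
    rcases n.eq_zero_or_pos with rfl | hn
    · simp [averageGain]
    · have hn' : (0 : ℝ) < n := by exact_mod_cast hn
      unfold averageGain
      rw [div_pow, div_le_iff₀ (by positivity)]
      refine h1.trans (le_of_eq ?_)
      field_simp
  calc ∫ ω, averageGain h n ω ^ 2 ∂P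
      ≤ ∫ ω, (n : ℝ)⁻¹ * ∑ j ∈ Finset.range n, (‖h j ω‖ ^ 2) ^ 2 ∂P :=
        integral_mono (memLp_averageGain hlaw n).integrable_sq
          ((integrable_finsetSum _ fun j _ => hsq j).const_mul _) hpt
    _ = (n : ℝ)⁻¹ * (n * ∫ ω, (‖h 0 ω‖ ^ 2) ^ 2 ∂P) := by
        rw [integral_const_mul, integral_finsetSum _ fun j _ => hsq j]
        simp_rw [heq]
        simp
    _ ≤ ∫ ω, (‖h 0 ω‖ ^ 2) ^ 2 ∂P := by
        rw [← mul_assoc]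
        refine mul_le_of_le_one_left (integral_nonneg fun ω => by positivity) ?_
        exact inv_mul_le_one

variable [IsProbabilityMeasure P]

lemma tendsto_averageGain (hlaw : ∀ j, HasLaw (h j) stdComplexGaussian P)
    (hind : iIndepFun h P) :
    ∀ᵐ ω ∂P, Tendsto (fun n => averageGain h n ω) atTop (𝓝 1) := by
  have := strong_law_ae_real (μ := P) (fun j ω => ‖h j ω‖ ^ 2)
    ((memLp_norm_sq_channel hlaw 0).integrable (by norm_num))
    (pairwise_indepFun_norm_sq_channel hind) (identDistrib_norm_sq_channel hlaw)
  rwa [integral_norm_sq_channel hlaw] at this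

lemma tendsto_integral_abs_averageGain_sub_one (hlaw : ∀ j, HasLaw (h j) stdComplexGaussian P)
    (hind : iIndepFun h P) :
    Tendsto (fun n => ∫ ω, |averageGain h n ω - 1| ∂P) atTop (𝓝 0) := by
  have := strong_law_Lp (μ := P) (p := 1) le_rfl (by norm_num) (fun j ω => ‖h j ω‖ ^ 2)
    ((memLp_norm_sq_channel hlaw 0).mono_exponent (by norm_num))
    (pairwise_indepFun_norm_sq_channel hind) (identDistrib_norm_sq_channel hlaw)
  rw [integral_norm_sq_channel hlaw] at this
  have h2 := (ENNReal.tendsto_toReal ENNReal.zero_ne_top).comp this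
  refine h2.congr fun n => ?_
  rw [Function.comp_apply, eLpNorm_one_eq_lintegral_enorm, ← integral_norm_eq_lintegral_enorm]
  · simp only [averageGain, smul_eq_mul, Real.norm_eq_abs, div_eq_inv_mul]
  · have := (memLp_averageGain hlaw n).aestronglyMeasurable.sub
      (aestronglyMeasurable_const (b := (1 : ℝ)))
    refine this.congr (Eventually.of_forall fun ω => ?_)
    simp [averageGain, div_eq_inv_mul]

end Channel

/-! ### Logarithmic growth -/

/-- Bernoulli's inequality (1 + y)^u ≤ 1 + uy for exponents in [0, 1], after taking logarithms; for
u ≥ 1 it reverses. -/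
lemma mul_log_one_add_le {u y : ℝ} (hu0 : 0 ≤ u) (hu1 : u ≤ 1) (hy : 0 ≤ y) :
    u * Real.log (1 + y) ≤ Real.log (1 + u * y) := by
  rw [← Real.log_rpow (by linarith)]
  exact Real.log_le_log (Real.rpow_pos_of_pos (by linarith) _)
    (rpow_one_add_le_one_add_mul_self (by linarith) hu0 hu1)

lemma log_one_add_mul_le {u y : ℝ} (hu : 1 ≤ u) (hy : 0 ≤ y) :
    Real.log (1 + u * y) ≤ u * Real.log (1 + y) := by
  rw [← Real.log_rpow (by linarith)]
  exact Real.log_le_log (by positivity) (one_add_mul_self_le_rpow_one_add (by linarith) hu)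

/-- The quotient lies between 1 and u by Bernoulli and monotonicity of the logarithm. Since the
bound does not involve y, it covers every ratio of antennas to density. -/
lemma abs_log_one_add_mul_div_sub_one_le {u y : ℝ} (hu : 0 ≤ u) (hy : 0 < y) :
    |Real.log (1 + u * y) / Real.log (1 + y) - 1| ≤ |u - 1| := by
  have hl : 0 < Real.log (1 + y) := Real.log_pos (by linarith)
  rcases le_total u 1 with h1 | h1
  · have h2 := mul_log_one_add_le hu h1 hy.le
    have h3 : Real.log (1 + u * y) ≤ Real.log (1 + y) :=
      Real.log_le_log (by positivity) (by nlinarith)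
    rw [abs_of_nonpos (by rw [sub_nonpos, div_le_one hl]; exact h3), abs_of_nonpos (by linarith)]
    have := (le_div_iff₀ hl).2 h2
    linarith
  · have h2 := log_one_add_mul_le h1 hy.le
    have h3 : Real.log (1 + y) ≤ Real.log (1 + u * y) :=
      Real.log_le_log (by positivity) (by nlinarith)
    rw [abs_of_nonneg (by rw [sub_nonneg, one_le_div hl]; exact h3), abs_of_nonneg (by linarith)]
    have := (div_le_iff₀ hl).2 h2
    linarith

/-- The growth function `l log₂(1 + κ N / l)` of the area spectral efficiency. -/
def growth (κ : ℝ) (N : ℝ → ℕ) (l : ℝ) : ℝ := l * Real.logb 2 (1 + κ * (N l / l))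

section Growth

variable {κ : ℝ} {N : ℝ → ℕ}

lemma eventually_natCast_pos (hN : Tendsto N atTop atTop) : ∀ᶠ l in atTop, (0 : ℝ) < N l := by
  filter_upwards [hN.eventually_gt_atTop 0] with l hl using by exact_mod_cast hl

lemma eventually_growth_pos (hκ : 0 < κ) (hN : Tendsto N atTop atTop) :
    ∀ᶠ l in atTop, 0 < growth κ N l := by
  filter_upwards [eventually_natCast_pos hN, eventually_gt_atTop 0] with l h1 h2
  have : 0 < κ * (N l / l) := by positivity
  exact mul_pos h2 (Real.logb_pos one_lt_two (by linarith))

lemma growth_isTheta (hκ : 0 < κ) :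
    growth κ N =Θ[atTop] fun l => l * Real.log (1 + N l / l) := by
  have hlog2 : 0 < Real.log 2 := Real.log_pos one_lt_two
  have hval : ∀ l, growth κ N l = (Real.log 2)⁻¹ * (l * Real.log (1 + κ * (N l / l))) := fun l => by
    rw [growth, Real.logb]; field_simp
  -- Replacing κ by `max κ 1` or `min κ 1` brings each direction into the range of one of the
  -- Bernoulli bounds.
  have hM : 0 < max κ 1 := lt_max_of_lt_right one_pos
  have hm : 0 < min κ 1 := lt_min hκ one_pos
  constructor
  · refine IsBigO.of_bound ((Real.log 2)⁻¹ * max κ 1) ?_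
    filter_upwards [eventually_gt_atTop 0] with l hl
    have hy : (0 : ℝ) ≤ N l / l := by positivity
    have h0 : 0 ≤ Real.log (1 + N l / l) := Real.log_nonneg (by linarith)
    have h1 : 0 ≤ Real.log (1 + κ * (N l / l)) := Real.log_nonneg (by nlinarith)
    rw [hval, Real.norm_of_nonneg (by positivity), Real.norm_of_nonneg (by positivity), mul_assoc]
    refine mul_le_mul_of_nonneg_left ?_ (by positivity)
    rw [mul_left_comm]
    refine mul_le_mul_of_nonneg_left ?_ hl.le
    refine le_trans ?_ (log_one_add_mul_le (le_max_right κ 1) hy)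
    exact Real.log_le_log (by positivity) (by gcongr; exact le_max_left _ _)
  · refine IsBigO.of_bound (Real.log 2 / min κ 1) ?_
    filter_upwards [eventually_gt_atTop 0] with l hl
    have hy : (0 : ℝ) ≤ N l / l := by positivity
    have h0 : 0 ≤ Real.log (1 + N l / l) := Real.log_nonneg (by linarith)
    have h1 : 0 ≤ Real.log (1 + κ * (N l / l)) := Real.log_nonneg (by nlinarith)
    rw [hval, Real.norm_of_nonneg (by positivity), Real.norm_of_nonneg (by positivity)]
    have h2 : Real.log 2 / min κ 1 * ((Real.log 2)⁻¹ * (l * Real.log (1 + κ * (N l / l)))) =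
        l * (Real.log (1 + κ * (N l / l)) / min κ 1) := by field_simp
    rw [h2]
    refine mul_le_mul_of_nonneg_left ?_ hl.le
    rw [le_div_iff₀' hm]
    refine (mul_log_one_add_le hm.le (min_le_right κ 1) hy).trans ?_
    exact Real.log_le_log (by positivity) (by gcongr; exact min_le_left _ _)

lemma tendsto_log_one_add_div {y : ℝ → ℝ} {F : Filter ℝ} (hy : Tendsto y F (𝓝 0))
    (hpos : ∀ᶠ l in F, 0 < y l) : Tendsto (fun l => Real.log (1 + y l) / y l) F (𝓝 1) := by
  have h1 : HasDerivAt (fun x : ℝ => Real.log (1 + x)) 1 0 := by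
    have := ((hasDerivAt_id (0 : ℝ)).const_add 1).log (by simp)
    simpa using this
  have h2 := h1.tendsto_slope_zero
  have h3 : Tendsto y F (𝓝[≠] 0) :=
    tendsto_nhdsWithin_iff.2 ⟨hy, hpos.mono fun l hl => hl.ne'⟩
  refine (h2.comp h3).congr fun l => ?_
  simp [div_eq_inv_mul]

/-- Few antennas per unit of density. -/
lemma tendsto_growth_div_of_atTop (hκ : 0 < κ) (hN : Tendsto N atTop atTop)
    (h : Tendsto (fun l => l / N l) atTop atTop) :
    Tendsto (fun l => growth κ N l / N l) atTop (𝓝 (κ / Real.log 2)) := by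
  have hy : Tendsto (fun l : ℝ => κ * (N l / l)) atTop (𝓝 0) := by
    have := (tendsto_inv_atTop_zero.comp h).const_mul κ
    simpa [Function.comp_def] using this
  have hpos : ∀ᶠ l : ℝ in atTop, 0 < κ * (N l / l) := by
    filter_upwards [eventually_natCast_pos hN, eventually_gt_atTop 0] with l h1 h2
    positivity
  have h1 := (tendsto_log_one_add_div hy hpos).mul_const (κ / Real.log 2)
  rw [one_mul] at h1
  refine h1.congr' ?_
  filter_upwards [eventually_natCast_pos hN, eventually_gt_atTop 0] with l h1 h2
  rw [growth, Real.logb]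
  field_simp

/-- Antennas proportional to the density. -/
lemma tendsto_growth_div_of_nhds {c : ℝ} (hκ : 0 < κ) (hc : 0 < c)
    (h : Tendsto (fun l => l / N l) atTop (𝓝 c)) :
    Tendsto (fun l => growth κ N l / l) atTop (𝓝 (Real.logb 2 (1 + κ / c))) := by
  have hy : Tendsto (fun l : ℝ => 1 + κ * (N l / l)) atTop (𝓝 (1 + κ / c)) := by
    have := ((h.inv₀ hc.ne').const_mul κ).const_add 1
    simpa [div_eq_mul_inv] using this
  have h1 : Tendsto (fun l => Real.logb 2 (1 + κ * (N l / l))) atTop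
      (𝓝 (Real.logb 2 (1 + κ / c))) := by
    have := (hy.log (by positivity)).div_const (Real.log 2)
    simpa only [Real.logb] using this
  refine h1.congr' ?_
  filter_upwards [eventually_gt_atTop 0] with l h2
  rw [growth]
  field_simp

lemma tendsto_ratio_atTop (hN : Tendsto N atTop atTop)
    (h : Tendsto (fun l => l / N l) atTop (𝓝 0)) :
    Tendsto (fun l => (N l : ℝ) / l) atTop atTop := by
  have h1 : Tendsto (fun l : ℝ => l / N l) atTop (𝓝[>] 0) := by
    refine tendsto_nhdsWithin_iff.2 ⟨h, ?_⟩
    filter_upwards [eventually_natCast_pos hN, eventually_gt_atTop 0] with l h1 h2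
    exact div_pos h2 h1
  simpa [Function.comp_def] using tendsto_inv_nhdsGT_zero.comp h1

/-- Many antennas per unit of density. -/
lemma tendsto_growth_div_of_zero (hκ : 0 < κ) (hN : Tendsto N atTop atTop)
    (h : Tendsto (fun l => l / N l) atTop (𝓝 0)) :
    Tendsto (fun l => growth κ N l / (l * Real.log (1 + N l / l))) atTop
      (𝓝 (1 / Real.log 2)) := by
  have hr := tendsto_ratio_atTop hN h
  have hlogr : Tendsto (fun l : ℝ => Real.log (1 + N l / l)) atTop atTop :=
    Real.tendsto_log_atTop.comp (tendsto_atTop_add_const_left _ _ hr)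
  have hq : Tendsto (fun l : ℝ => (1 + κ * (N l / l)) / (1 + N l / l)) atTop (𝓝 κ) := by
    have h1 : Tendsto (fun l : ℝ => κ + (1 - κ) / (1 + N l / l)) atTop (𝓝 (κ + 0)) :=
      ((tendsto_atTop_add_const_left _ 1 hr).const_div_atTop _).const_add κ
    rw [add_zero] at h1
    refine h1.congr' ?_
    filter_upwards [hr.eventually_ge_atTop 0] with l hl
    have : 1 + (N l : ℝ) / l ≠ 0 := by positivity
    generalize (N l : ℝ) / l = x at *
    field_simp
    ring
  -- The factor κ changes the logarithm by a term tending to log κ, negligible against the diverging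
  -- log(1 + N/l).
  have h2 : Tendsto (fun l : ℝ => 1 + Real.log ((1 + κ * (N l / l)) / (1 + N l / l)) /
      Real.log (1 + N l / l)) atTop (𝓝 (1 + 0)) :=
    ((hq.log hκ.ne').div_atTop hlogr).const_add 1
  have h3 := h2.div_const (Real.log 2)
  rw [add_zero] at h3
  refine h3.congr' ?_
  filter_upwards [eventually_natCast_pos hN, eventually_gt_atTop 0] with l hn hl
  have h5 : 0 < (N l : ℝ) / l := by positivity
  have h4 : 0 < Real.log (1 + N l / l) := Real.log_pos (by linarith)
  rw [growth, Real.logb, Real.log_div (by positivity) (by positivity)]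
  generalize Real.log (1 + κ * ((N l : ℝ) / l)) = a
  generalize Real.log (1 + (N l : ℝ) / l) = b at *
  field_simp
  ring

end Growth

/-! ### Convergence of the normalized area spectral efficiency -/

section Normalized

variable {Ω : Type*} (L : ℝ → ℝ) (noise : ℝ) (N : ℝ → ℕ)
  (X : ℕ → Ω → EuclideanSpace ℝ (Fin 2) × ℝ) (g : ℕ → Ω → ℝ) (h : ℕ → Ω → ℂ)

/-- The reciprocal of interference plus noise. -/
def reciprocalDisturbance (l : ℝ) (ω : Ω) : ℝ :=
  ((interference L X g l ω + ENNReal.ofReal noise)⁻¹).toReal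

/-- The product of the path gain to the serving station and the reciprocal of interference plus
noise, normalized to tend to `1`. -/
def normalizedPathSINR (l : ℝ) (ω : Ω) : ℝ :=
  L (servingDistance X l ω) / L 0 * (totalGain L * l * reciprocalDisturbance L noise X g l ω)

/-- The event that the interference is at least `δ l`. -/
def strongInterference (δ l : ℝ) : Set Ω := {ω | ENNReal.ofReal (δ * l) ≤ interference L X g l ω}

variable {L noise N X g h}

lemma reciprocalDisturbance_nonneg (l : ℝ) (ω : Ω) : 0 ≤ reciprocalDisturbance L noise X g l ω :=
  ENNReal.toReal_nonneg

lemma reciprocalDisturbance_le_inv_noise (hnoise : 0 < noise) (l : ℝ) (ω : Ω) :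
    reciprocalDisturbance L noise X g l ω ≤ noise⁻¹ := by
  refine ENNReal.toReal_le_of_le_ofReal (by positivity) ?_
  rw [ENNReal.ofReal_inv_of_pos hnoise, ENNReal.inv_le_inv]
  exact le_add_self

lemma reciprocalDisturbance_le_of_mem_strongInterference {δ l : ℝ} (hδ : 0 < δ) (hl : 0 < l)
    {ω : Ω} (hω : ω ∈ strongInterference L X g δ l) :
    reciprocalDisturbance L noise X g l ω ≤ (δ * l)⁻¹ := by
  refine ENNReal.toReal_le_of_le_ofReal (by positivity) ?_
  rw [ENNReal.ofReal_inv_of_pos (by positivity), ENNReal.inv_le_inv]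
  exact le_add_right hω

/-- Separates the antenna average, the normalized geometry and interference, and the deterministic
scale κN/l. -/
lemma SINR_eq (hL : PhysicallyFeasible L) {l : ℝ} (ω : Ω) (hl : 0 < l) (hN : (0 : ℝ) < N l) :
    SINR L noise N X g h l ω =
      averageGain h (N l) ω * normalizedPathSINR L noise X g l ω *
        (L 0 / totalGain L * (N l / l)) := by
  have h0 := hL.zero_pos
  have hμ := hL.lintegral_planarGain.2
  have hG : 0 ≤ servingGain N h l ω := by unfold servingGain; positivity
  rw [SINR, div_eq_mul_inv, ENNReal.toReal_mul, ENNReal.toReal_ofReal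
    (mul_nonneg (hL.nonneg _ (servingDistance_nonneg l ω)) hG), ← reciprocalDisturbance]
  unfold normalizedPathSINR averageGain servingGain
  field_simp

lemma normalizedPathSINR_nonneg (hL : PhysicallyFeasible L) {l : ℝ} (hl : 0 ≤ l) (ω : Ω) :
    0 ≤ normalizedPathSINR L noise X g l ω :=
  mul_nonneg (div_nonneg (hL.nonneg _ (servingDistance_nonneg l ω)) hL.zero_pos.le)
    (mul_nonneg (mul_nonneg ENNReal.toReal_nonneg hl) (reciprocalDisturbance_nonneg l ω))

lemma normalizedPathSINR_le (hL : PhysicallyFeasible L) {l b : ℝ} (hl : 0 ≤ l) {ω : Ω}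
    (hb : reciprocalDisturbance L noise X g l ω ≤ b) :
    normalizedPathSINR L noise X g l ω ≤ totalGain L * l * b := by
  have hμ := hL.lintegral_planarGain.2
  have h1 : L (servingDistance X l ω) / L 0 ≤ 1 :=
    (div_le_one hL.zero_pos).2 (hL.le_zero _ (servingDistance_nonneg l ω))
  refine (mul_le_of_le_one_left ?_ h1).trans ?_
  · exact mul_nonneg (by positivity) (reciprocalDisturbance_nonneg l ω)
  · gcongr

lemma abs_ASE_div_growth_sub_one_le (hL : PhysicallyFeasible L) {l : ℝ} (ω : Ω) (hl : 0 < l)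
    (hN : (0 : ℝ) < N l) :
    |ASE L noise N X g h l ω / growth (L 0 / totalGain L) N l - 1| ≤
      |averageGain h (N l) ω * normalizedPathSINR L noise X g l ω - 1| := by
  have h0 := hL.zero_pos
  have hμ := hL.lintegral_planarGain.2
  have hy : 0 < L 0 / totalGain L * (N l / l) := by positivity
  have hu : 0 ≤ averageGain h (N l) ω * normalizedPathSINR L noise X g l ω :=
    mul_nonneg (averageGain_nonneg _ _) (normalizedPathSINR_nonneg hL hl.le ω)
  refine le_trans (le_of_eq ?_) (abs_log_one_add_mul_div_sub_one_le hu hy)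
  have hlog2 : 0 < Real.log 2 := Real.log_pos one_lt_two
  have hlogy := Real.log_pos (show 1 < 1 + L 0 / totalGain L * (N l / l) by linarith)
  rw [ASE, growth, SINR_eq hL ω hl hN, Real.logb, Real.logb]
  congr 2
  rw [mul_div_mul_left _ _ hl.ne', div_div_div_cancel_right₀ hlog2.ne']

/-- An integrable bound for `|ASE / growth - 1|` whose integral tends to zero. -/
def deviationBound {Ω : Type*} (L : ℝ → ℝ) (noise δ : ℝ) (N : ℝ → ℕ)
    (X : ℕ → Ω → EuclideanSpace ℝ (Fin 2) × ℝ) (g : ℕ → Ω → ℝ) (h : ℕ → Ω → ℂ) (l : ℝ)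
    (ω : Ω) : ℝ :=
  totalGain L / δ * |averageGain h (N l) ω - 1| +
    |(strongInterference L X g δ l).indicator (normalizedPathSINR L noise X g l) ω - 1| +
    totalGain L / noise * (averageGain h (N l) ω ^ 2 / l +
      l ^ 3 * (strongInterference L X g δ l)ᶜ.indicator 1 ω)

/-- With strong interference, W ≤ μ/δ and GW - 1 = W(G - 1) + (W - 1). Otherwise W ≤ μl/noise, and
Gl ≤ G²/l + l³ separates the gain from the event: the first term has mean O(1/l), and l³ is beaten
by the exponentially small probability. -/
lemma abs_averageGain_mul_sub_one_le_deviationBound (hL : PhysicallyFeasible L)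
    (hnoise : 0 < noise) {δ l : ℝ} (hδ : 0 < δ) (hl : 0 < l) (ω : Ω) :
    |averageGain h (N l) ω * normalizedPathSINR L noise X g l ω - 1| ≤
      deviationBound L noise δ N X g h l ω := by
  have hμ := hL.lintegral_planarGain.2
  have hG := averageGain_nonneg (h := h) (N l) ω
  have hW := normalizedPathSINR_nonneg (noise := noise) (X := X) (g := g) hL hl.le ω
  unfold deviationBound
  by_cases hω : ω ∈ strongInterference L X g δ l
  · have hb := normalizedPathSINR_le hL hl.le
      (reciprocalDisturbance_le_of_mem_strongInterference (noise := noise) hδ hl hω)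
    have hK : totalGain L * l * (δ * l)⁻¹ = totalGain L / δ := by field_simp
    rw [hK] at hb
    have hωc : ω ∉ (strongInterference L X g δ l)ᶜ := fun hc => hc hω
    rw [indicator_of_mem hω, indicator_of_notMem hωc, mul_zero, add_zero]
    have h1 : 0 ≤ totalGain L / noise * (averageGain h (N l) ω ^ 2 / l) := by positivity
    calc |averageGain h (N l) ω * normalizedPathSINR L noise X g l ω - 1|
        = |normalizedPathSINR L noise X g l ω * (averageGain h (N l) ω - 1) +
            (normalizedPathSINR L noise X g l ω - 1)| := by congr 1; ring
      _ ≤ |normalizedPathSINR L noise X g l ω * (averageGain h (N l) ω - 1)| +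
            |normalizedPathSINR L noise X g l ω - 1| := abs_add_le _ _
      _ ≤ totalGain L / δ * |averageGain h (N l) ω - 1| +
            |normalizedPathSINR L noise X g l ω - 1| := by
          rw [abs_mul, abs_of_nonneg hW]
          gcongr
      _ ≤ _ := by linarith
  · have hb := normalizedPathSINR_le hL hl.le
      (reciprocalDisturbance_le_inv_noise (L := L) (X := X) (g := g) hnoise l ω)
    have hωc : ω ∈ (strongInterference L X g δ l)ᶜ := hω
    rw [indicator_of_notMem hω, indicator_of_mem hωc, Pi.one_apply, mul_one]
    have h1 : averageGain h (N l) ω * normalizedPathSINR L noise X g l ω ≤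
        totalGain L / noise * (averageGain h (N l) ω ^ 2 / l + l ^ 3) := by
      have h2 : averageGain h (N l) ω * l ≤ averageGain h (N l) ω ^ 2 / l + l ^ 3 := by
        rw [div_add' _ _ _ hl.ne', le_div_iff₀ hl]
        nlinarith [sq_nonneg (averageGain h (N l) ω - l ^ 2), sq_nonneg (averageGain h (N l) ω),
          sq_nonneg (l ^ 2)]
      calc averageGain h (N l) ω * normalizedPathSINR L noise X g l ω
          ≤ averageGain h (N l) ω * (totalGain L * l * noise⁻¹) := by gcongr
        _ = totalGain L / noise * (averageGain h (N l) ω * l) := by ring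
        _ ≤ _ := by gcongr
    have h3 : 0 ≤ totalGain L / δ * |averageGain h (N l) ω - 1| := by positivity
    have h4 : 0 ≤ averageGain h (N l) ω * normalizedPathSINR L noise X g l ω := mul_nonneg hG hW
    -- Off the event the indicator vanishes, so the middle term of the bound equals 1 and takes care
    -- of GW - 1 ≥ -1.
    rw [zero_sub, abs_neg, abs_one, abs_le]
    constructor <;> linarith

lemma indicator_strongInterference_mem_Icc (hL : PhysicallyFeasible L) {δ l : ℝ} (hδ : 0 < δ)
    (hl : 0 < l) (ω : Ω) :
    (strongInterference L X g δ l).indicator (normalizedPathSINR L noise X g l) ω ∈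
      Icc 0 (totalGain L / δ) := by
  have hμ := hL.lintegral_planarGain.2
  by_cases hω : ω ∈ strongInterference L X g δ l
  · have hb := normalizedPathSINR_le hL hl.le
      (reciprocalDisturbance_le_of_mem_strongInterference (noise := noise) hδ hl hω)
    have hK : totalGain L * l * (δ * l)⁻¹ = totalGain L / δ := by field_simp
    rw [indicator_of_mem hω]
    exact ⟨normalizedPathSINR_nonneg hL hl.le ω, hK ▸ hb⟩
  · rw [indicator_of_notMem hω]
    exact ⟨le_rfl, by positivity⟩

end Normalized

/-! ### Limits of the normalized area spectral efficiency, almost surely and in mean -/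

section Limits

variable {Ω : Type*} [MeasurableSpace Ω] {P : Measure Ω}
  {L : ℝ → ℝ} {noise : ℝ} {N : ℝ → ℕ}
  {X : ℕ → Ω → EuclideanSpace ℝ (Fin 2) × ℝ} {g : ℕ → Ω → ℝ} {h : ℕ → Ω → ℂ}

lemma IsMISOModel.aemeasurable_interference (hm : IsMISOModel X g h P)
    (hL : PhysicallyFeasible L) (l : ℝ) : AEMeasurable (interference L X g l) P :=
  _root_.aemeasurable_interference hm.poisson.measurable (fun n => (hm.fading_law n).aemeasurable)
    hL.measurable l

lemma IsMISOModel.aemeasurable_normalizedPathSINR (hm : IsMISOModel X g h P)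
    (hL : PhysicallyFeasible L) (l : ℝ) :
    AEMeasurable (normalizedPathSINR L noise X g l) P := by
  have h1 := ((hm.aemeasurable_interference hL l).add_const (ENNReal.ofReal noise)).inv
  exact ((hL.measurable.comp (measurable_servingDistance hm.poisson.measurable l)).div_const
    _).aemeasurable.mul (h1.ennreal_toReal.const_mul _)

lemma IsMISOModel.nullMeasurableSet_strongInterference (hm : IsMISOModel X g h P)
    (hL : PhysicallyFeasible L) (δ l : ℝ) : NullMeasurableSet (strongInterference L X g δ l) P :=
  nullMeasurableSet_le aemeasurable_const (hm.aemeasurable_interference hL l)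

lemma IsMISOModel.aestronglyMeasurable_ASE (hm : IsMISOModel X g h P)
    (hL : PhysicallyFeasible L) (l : ℝ) : AEStronglyMeasurable (ASE L noise N X g h l) P := by
  have hG : AEMeasurable (servingGain N h l) P :=
    Finset.aemeasurable_fun_sum _ fun j _ =>
      measurable_norm_sq_complex.comp_aemeasurable (hm.channel_law j).aemeasurable
  have h1 : AEMeasurable (SINR L noise N X g h l) P :=
    ((((hL.measurable.comp (measurable_servingDistance hm.poisson.measurable l)).aemeasurable.mul
      hG).ennreal_ofReal).div
        ((hm.aemeasurable_interference hL l).add_const (ENNReal.ofReal noise))).ennreal_toReal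
  exact ((((h1.const_add 1).log).div_const (Real.log 2)).const_mul l).aestronglyMeasurable

variable [IsProbabilityMeasure P]

lemma IsExpMarkedPoisson.tendsto_normalizedPathSINR
    (hm : IsExpMarkedPoisson X g stationIntensity P)
    (hL : PhysicallyFeasible L) (hnoise : 0 < noise) :
    ∀ᵐ ω ∂P, Tendsto (fun l => normalizedPathSINR L noise X g l ω) atTop (𝓝 1) := by
  have h0 := hL.zero_pos
  have hμ := hL.lintegral_planarGain.2
  filter_upwards [hm.tendsto_servingDistance, hm.tendsto_interference_div hL] with ω h1 h2
  have e1 : Tendsto (fun l => L (servingDistance X l ω) / L 0) atTop (𝓝 1) := by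
    -- Continuity of the gain at 0 is only one-sided.
    have h3 : Tendsto (fun l => servingDistance X l ω) atTop (𝓝[Ici 0] 0) :=
      tendsto_nhdsWithin_iff.2 ⟨h1, Eventually.of_forall fun l => servingDistance_nonneg l ω⟩
    have h4 := (hL.continuous_zero.tendsto.comp h3).div_const (L 0)
    rwa [div_self h0.ne'] at h4
  have e2 : Tendsto (fun l => totalGain L * l * reciprocalDisturbance L noise X g l ω) atTop
      (𝓝 1) := by
    have h3 : Tendsto (fun l => totalGain L / ((interference L X g l ω).toReal / l + noise / l))
        atTop (𝓝 (totalGain L / (totalGain L + 0))) :=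
      tendsto_const_nhds.div (h2.2.add (tendsto_id.const_div_atTop noise)) (by positivity)
    rw [add_zero, div_self hμ.ne'] at h3
    refine h3.congr' ?_
    filter_upwards [eventually_gt_atTop 0] with l hl
    have h4 : 0 ≤ (interference L X g l ω).toReal := ENNReal.toReal_nonneg
    rw [reciprocalDisturbance, ENNReal.toReal_inv, ENNReal.toReal_add (h2.1 l)
      ENNReal.ofReal_ne_top, ENNReal.toReal_ofReal hnoise.le]
    field_simp
  have := e1.mul e2
  rwa [one_mul] at this

lemma IsMISOModel.tendsto_ASE_div_growth (hm : IsMISOModel X g h P)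
    (hL : PhysicallyFeasible L) (hnoise : 0 < noise) (hN : Tendsto N atTop atTop) :
    ∀ᵐ ω ∂P, Tendsto (fun l => ASE L noise N X g h l ω / growth (L 0 / totalGain L) N l) atTop
      (𝓝 1) := by
  filter_upwards [hm.isExpMarkedPoisson.tendsto_normalizedPathSINR hL hnoise,
    tendsto_averageGain hm.channel_law hm.channel_indep] with ω h1 h2
  have h3 := (h2.comp hN).mul h1
  rw [one_mul] at h3
  have h4 := (tendsto_sub_nhds_zero_iff.2 h3).abs
  rw [abs_zero] at h4
  rw [← tendsto_sub_nhds_zero_iff, tendsto_zero_iff_abs_tendsto_zero]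
  refine squeeze_zero' (Eventually.of_forall fun l => abs_nonneg _) ?_ h4
  filter_upwards [eventually_natCast_pos hN, eventually_gt_atTop 0] with l hn hl
  exact abs_ASE_div_growth_sub_one_le hL ω hl hn

lemma IsMISOModel.integrable_indicator_strongInterference_sub_one (hm : IsMISOModel X g h P)
    (hL : PhysicallyFeasible L) {δ l : ℝ} (hδ : 0 < δ) (hl : 0 < l) :
    Integrable (fun ω => |(strongInterference L X g δ l).indicator
      (normalizedPathSINR L noise X g l) ω - 1|) P := by
  refine (Integrable.sub ?_ (integrable_const 1)).abs
  refine Integrable.of_bound (((hm.aemeasurable_normalizedPathSINR hL l).indicator₀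
    (hm.nullMeasurableSet_strongInterference hL δ l)).aestronglyMeasurable) (totalGain L / δ)
    (Eventually.of_forall fun ω => ?_)
  have := indicator_strongInterference_mem_Icc (noise := noise) (X := X) (g := g) hL hδ hl ω
  rw [Real.norm_of_nonneg this.1]
  exact this.2

lemma IsMISOModel.integrable_indicator_compl_strongInterference (hm : IsMISOModel X g h P)
    (hL : PhysicallyFeasible L) (δ l : ℝ) :
    Integrable ((strongInterference L X g δ l)ᶜ.indicator (1 : Ω → ℝ)) P :=
  (integrable_const (1 : ℝ)).indicator₀ (hm.nullMeasurableSet_strongInterference hL δ l).compl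

lemma IsMISOModel.integrable_deviationBound (hm : IsMISOModel X g h P)
    (hL : PhysicallyFeasible L) {δ l : ℝ} (hδ : 0 < δ) (hl : 0 < l) :
    Integrable (deviationBound L noise δ N X g h l) P := by
  have hG := memLp_averageGain hm.channel_law (N l)
  refine ((((hG.integrable (by norm_num)).sub (integrable_const 1)).abs.const_mul _).add
    (hm.integrable_indicator_strongInterference_sub_one hL hδ hl)).add
    (((hG.integrable_sq.div_const l).add
      ((hm.integrable_indicator_compl_strongInterference hL δ l).const_mul _)).const_mul _)

/-- The indicator supplies a constant dominating function, and since δ is below the almost sure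
limit of interference/l, it is eventually 1 along almost every path. -/
lemma IsMISOModel.tendsto_integral_abs_indicator_sub_one (hm : IsMISOModel X g h P)
    (hL : PhysicallyFeasible L) (hnoise : 0 < noise) {δ : ℝ} (hδ : 0 < δ)
    (hδμ : δ < totalGain L) :
    Tendsto (fun l => ∫ ω, |(strongInterference L X g δ l).indicator
      (normalizedPathSINR L noise X g l) ω - 1| ∂P) atTop (𝓝 0) := by
  have hμ := hL.lintegral_planarGain.2
  have hlim : ∀ᵐ ω ∂P, Tendsto (fun l => |(strongInterference L X g δ l).indicator
      (normalizedPathSINR L noise X g l) ω - 1|) atTop (𝓝 0) := by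
    filter_upwards [hm.isExpMarkedPoisson.tendsto_normalizedPathSINR hL hnoise,
      hm.isExpMarkedPoisson.tendsto_interference_div hL] with ω h1 h2
    have h3 := (tendsto_sub_nhds_zero_iff.2 h1).abs
    rw [abs_zero] at h3
    refine h3.congr' ?_
    filter_upwards [h2.2.eventually (lt_mem_nhds hδμ), eventually_gt_atTop 0] with l hl hl0
    have hω : ω ∈ strongInterference L X g δ l :=
      ENNReal.ofReal_le_of_le_toReal ((lt_div_iff₀ hl0).1 hl).le
    rw [indicator_of_mem hω]
  have := tendsto_integral_filter_of_dominated_convergence (μ := P)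
    (fun _ => totalGain L / δ + 1) ?_ ?_ (integrable_const _) hlim
  · simpa using this
  · filter_upwards [eventually_gt_atTop 0] with l hl
    exact (hm.integrable_indicator_strongInterference_sub_one hL hδ hl).aestronglyMeasurable
  · filter_upwards [eventually_gt_atTop 0] with l hl
    refine Eventually.of_forall fun ω => ?_
    have := indicator_strongInterference_mem_Icc (noise := noise) (X := X) (g := g) hL hδ hl ω
    rw [Real.norm_eq_abs, abs_abs, abs_le]
    constructor <;> linarith [this.1, this.2]

lemma tendsto_pow_three_mul_exp_neg_mul {c : ℝ} (hc : 0 < c) :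
    Tendsto (fun l : ℝ => l ^ 3 * (2 * Real.exp (-(c * l)))) atTop (𝓝 0) := by
  have h1 := ((Real.tendsto_pow_mul_exp_neg_atTop_nhds_zero 3).comp
    (tendsto_id.const_mul_atTop hc)).const_mul (2 / c ^ 3)
  rw [mul_zero] at h1
  refine h1.congr fun l => ?_
  simp only [Function.comp_apply, id]
  field_simp

lemma IsMISOModel.exists_tendsto_integral_deviationBound (hm : IsMISOModel X g h P)
    (hL : PhysicallyFeasible L) (hnoise : 0 < noise) (hN : Tendsto N atTop atTop) :
    ∃ δ, 0 < δ ∧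
      Tendsto (fun l => ∫ ω, deviationBound L noise δ N X g h l ω ∂P) atTop (𝓝 0) := by
  have hμ := hL.lintegral_planarGain.2
  obtain ⟨δ₀, c, hδ₀, hc, hbad⟩ := hm.isExpMarkedPoisson.measure_interference_lt_le hL
  -- Below `δ₀` for the exponential tail bound, and strictly below the total gain so that strong
  -- interference eventually holds almost surely.
  set δ := min δ₀ (totalGain L / 2) with hδdef
  have hδ : 0 < δ := lt_min hδ₀ (by positivity)
  have hδμ : δ < totalGain L := (min_le_right _ _).trans_lt (by linarith)
  refine ⟨δ, hδ, ?_⟩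
  have h1 := ((tendsto_integral_abs_averageGain_sub_one hm.channel_law hm.channel_indep).comp
    hN).const_mul (totalGain L / δ)
  have h2 := hm.tendsto_integral_abs_indicator_sub_one hL hnoise hδ hδμ
  have h3 : Tendsto (fun l => ∫ ω, averageGain h (N l) ω ^ 2 / l ∂P) atTop (𝓝 0) := by
    refine squeeze_zero' (g := fun l => (∫ ω, (‖h 0 ω‖ ^ 2) ^ 2 ∂P) / l) ?_ ?_
      (tendsto_id.const_div_atTop _)
    · filter_upwards [eventually_gt_atTop 0] with l hl
      exact integral_nonneg fun ω => by positivity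
    · filter_upwards [eventually_gt_atTop 0] with l hl
      rw [integral_div]
      refine div_le_div_of_nonneg_right ?_ hl.le
      exact integral_averageGain_sq_le hm.channel_law (N l)
  have h4 : Tendsto (fun l => l ^ 3 * ∫ ω, (strongInterference L X g δ l)ᶜ.indicator 1 ω ∂P) atTop
      (𝓝 (0 : ℝ)) := by
    refine squeeze_zero' ?_ ?_ (tendsto_pow_three_mul_exp_neg_mul hc)
    · filter_upwards [eventually_gt_atTop 0] with l hl
      exact mul_nonneg (by positivity)
        (integral_nonneg fun ω => indicator_nonneg (fun _ _ => zero_le_one) _)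
    · filter_upwards [eventually_gt_atTop 0] with l hl
      refine mul_le_mul_of_nonneg_left ?_ (by positivity)
      have hsub : (strongInterference L X g δ l)ᶜ ⊆
          {ω | interference L X g l ω < ENNReal.ofReal (δ₀ * l)} := by
        intro ω hω
        have hω' : ¬ ENNReal.ofReal (δ * l) ≤ interference L X g l ω := hω
        refine (not_le.1 hω').trans_le (ENNReal.ofReal_le_ofReal ?_)
        gcongr
        exact min_le_left _ _
      have hind : ∫ ω, (strongInterference L X g δ l)ᶜ.indicator (1 : Ω → ℝ) ω ∂P =
          P.real (strongInterference L X g δ l)ᶜ := by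
        rw [integral_indicator₀ (hm.nullMeasurableSet_strongInterference hL δ l).compl]
        simp
      rw [hind]
      exact (measureReal_mono hsub).trans (hbad l hl)
  have h5 := (h1.add h2).add ((h3.add h4).const_mul (totalGain L / noise))
  simp only [mul_zero, add_zero] at h5
  refine h5.congr' ?_
  filter_upwards [eventually_gt_atTop 0] with l hl
  have hG := memLp_averageGain hm.channel_law (N l)
  have i1 : Integrable (fun ω => totalGain L / δ * |averageGain h (N l) ω - 1|) P :=
    ((hG.integrable (by norm_num)).sub (integrable_const 1)).abs.const_mul _
  have i2 := hm.integrable_indicator_strongInterference_sub_one (noise := noise) hL hδ hl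
  have i3 : Integrable (fun ω => averageGain h (N l) ω ^ 2 / l) P := hG.integrable_sq.div_const l
  have i4 := (hm.integrable_indicator_compl_strongInterference hL δ l).const_mul (l ^ 3)
  have i12 := i1.fun_add i2
  have i34 := (i3.fun_add i4).const_mul (totalGain L / noise)
  unfold deviationBound
  rw [integral_add i12 i34, integral_add i1 i2, integral_const_mul,
    integral_const_mul, integral_add i3 i4, integral_const_mul]
  rfl

/-- The deviation bound dominates ASE/growth - 1. Its integrability gives that of the area spectral
efficiency, and its vanishing integral gives convergence of the mean. -/
lemma IsMISOModel.integrable_ASE_and_tendsto_integral_div_growth (hm : IsMISOModel X g h P)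
    (hL : PhysicallyFeasible L) (hnoise : 0 < noise) (hN : Tendsto N atTop atTop) :
    (∀ᶠ l in atTop, Integrable (ASE L noise N X g h l) P) ∧
      Tendsto (fun l => (∫ ω, ASE L noise N X g h l ω ∂P) / growth (L 0 / totalGain L) N l) atTop
        (𝓝 1) := by
  have h0 := hL.zero_pos
  have hμ := hL.lintegral_planarGain.2
  obtain ⟨δ, hδ, hlim⟩ := hm.exists_tendsto_integral_deviationBound hL hnoise hN
  set d := growth (L 0 / totalGain L) N with hd
  have hdpos : ∀ᶠ l in atTop, 0 < d l := eventually_growth_pos (by positivity) hN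
  have hle : ∀ᶠ l in atTop, ∀ ω, ‖ASE L noise N X g h l ω / d l - 1‖ ≤
      deviationBound L noise δ N X g h l ω := by
    filter_upwards [eventually_natCast_pos hN, eventually_gt_atTop 0] with l hn hl ω
    exact (abs_ASE_div_growth_sub_one_le hL ω hl hn).trans
      (abs_averageGain_mul_sub_one_le_deviationBound hL hnoise hδ hl ω)
  have hint : ∀ᶠ l in atTop, Integrable (fun ω => ASE L noise N X g h l ω / d l - 1) P := by
    filter_upwards [hle, eventually_gt_atTop 0] with l h1 hl
    refine (hm.integrable_deviationBound hL hδ hl).mono' ?_ (Eventually.of_forall h1)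
    exact (((hm.aestronglyMeasurable_ASE hL l).aemeasurable.div_const _).sub_const
      _).aestronglyMeasurable
  have hint2 : ∀ᶠ l in atTop, Integrable (ASE L noise N X g h l) P := by
    filter_upwards [hint, hdpos] with l h1 h2
    refine ((h1.add (integrable_const 1)).mul_const (d l)).congr (Eventually.of_forall fun ω => ?_)
    simp only [Pi.add_apply, sub_add_cancel]
    exact div_mul_cancel₀ _ h2.ne'
  refine ⟨hint2, ?_⟩
  rw [← tendsto_sub_nhds_zero_iff]
  refine squeeze_zero_norm' ?_ hlim
  filter_upwards [hle, hint2, eventually_gt_atTop 0] with l h1 h2 hl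
  have h3 : (∫ ω, ASE L noise N X g h l ω ∂P) / d l - 1 =
      ∫ ω, (ASE L noise N X g h l ω / d l - 1) ∂P := by
    rw [integral_sub (h2.div_const _) (integrable_const 1), integral_div]
    simp
  rw [h3]
  exact norm_integral_le_of_norm_le (hm.integrable_deviationBound hL hδ hl)
    (Eventually.of_forall h1)

end Limits

/-! ### Transfer from `growth` to the stated scales -/

section Scales

variable {F d s : ℝ → ℝ}

lemma tendsto_div_of_tendsto_div_growth (hd : ∀ᶠ l in atTop, 0 < d l)
    (hF : Tendsto (fun l => F l / d l) atTop (𝓝 1)) {C : ℝ}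
    (hs : Tendsto (fun l => d l / s l) atTop (𝓝 C)) :
    Tendsto (fun l => F l / s l) atTop (𝓝 C) := by
  have := hF.mul hs
  rw [one_mul] at this
  refine this.congr' ?_
  filter_upwards [hd] with l hl
  exact div_mul_div_cancel₀ hl.ne'

lemma tendsto_atTop_of_tendsto_div {C : ℝ} (hC : 0 < C) (hs : Tendsto s atTop atTop)
    (hF : Tendsto (fun l => F l / s l) atTop (𝓝 C)) : Tendsto F atTop atTop := by
  refine (hF.pos_mul_atTop hC hs).congr' ?_
  filter_upwards [hs.eventually_gt_atTop 0] with l hl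
  exact div_mul_cancel₀ _ hl.ne'

lemma isTheta_of_tendsto_div_one (hd : ∀ᶠ l in atTop, 0 < d l)
    (hF : Tendsto (fun l => F l / d l) atTop (𝓝 1)) : F =Θ[atTop] d := by
  refine IsEquivalent.isTheta ?_
  refine (isEquivalent_iff_tendsto_one ?_).2 hF
  filter_upwards [hd] with l hl using hl.ne'

lemma GrowsAtScale.of_tendsto_div {Ω : Type*} [MeasurableSpace Ω] {P : Measure Ω}
    {E : ℝ → Ω → ℝ} (hd : ∀ᶠ l in atTop, 0 < d l)
    (hE : ∀ᵐ ω ∂P, Tendsto (fun l => E l ω / d l) atTop (𝓝 1))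
    (hmean : Tendsto (fun l => (∫ ω, E l ω ∂P) / d l) atTop (𝓝 1))
    (hs : Tendsto s atTop atTop) {C : ℝ} (hC : 0 < C)
    (hds : Tendsto (fun l => d l / s l) atTop (𝓝 C)) : GrowsAtScale P E s := by
  have h1 : ∀ᵐ ω ∂P, Tendsto (fun l => E l ω / s l) atTop (𝓝 C) :=
    hE.mono fun ω hω => tendsto_div_of_tendsto_div_growth hd hω hds
  have h2 := tendsto_div_of_tendsto_div_growth hd hmean hds
  exact ⟨h1.mono fun ω hω => tendsto_atTop_of_tendsto_div hC hs hω,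
    tendsto_atTop_of_tendsto_div hC hs h2, C, hC, h1, h2⟩

end Scales

end

theorem theorem2 {Ω : Type*} [MeasurableSpace Ω] (P : Measure Ω) [IsProbabilityMeasure P]
    (L : ℝ → ℝ) (hL : PhysicallyFeasible L) (hL' : TractableLowerBound L)
    (noise : ℝ) (hnoise : 0 < noise)
    (N : ℝ → ℕ) (hN_mono : MonotoneOn N (Ici 0)) (hN_zero : N 0 = 0)
    (hN_top : Tendsto N atTop atTop)
    (X : ℕ → Ω → EuclideanSpace ℝ (Fin 2) × ℝ) (g : ℕ → Ω → ℝ) (h : ℕ → Ω → ℂ)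
    (hmodel : IsMISOModel X g h P) :
    (∀ᶠ l in atTop, Integrable (ASE L noise N X g h l) P) ∧
    (∀ᵐ ω ∂P, (fun l => ASE L noise N X g h l ω) =Θ[atTop]
      fun l => l * Real.log (1 + N l / l)) ∧
    ((fun l => ∫ ω, ASE L noise N X g h l ω ∂P) =Θ[atTop]
      fun l => l * Real.log (1 + N l / l)) ∧
    (Tendsto (fun l => l / N l) atTop atTop →
      GrowsAtScale P (ASE L noise N X g h) (fun l => N l)) ∧
    (∀ c : ℝ, 0 < c → Tendsto (fun l => l / N l) atTop (𝓝 c) →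
      GrowsAtScale P (ASE L noise N X g h) (fun l => l)) ∧
    (Tendsto (fun l => l / N l) atTop (𝓝 0) →
      GrowsAtScale P (ASE L noise N X g h) (fun l => l * Real.log (1 + N l / l))) := by
  have h0 := hL.zero_pos
  have hμ := hL.lintegral_planarGain.2
  have hκ : 0 < L 0 / totalGain L := by positivity
  have hlog2 : 0 < Real.log 2 := Real.log_pos one_lt_two
  have hd := eventually_growth_pos hκ hN_top
  have hae := hmodel.tendsto_ASE_div_growth hL hnoise hN_top
  obtain ⟨hint, hmean⟩ := hmodel.integrable_ASE_and_tendsto_integral_div_growth hL hnoise hN_top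
  -- With κ = L(0)/μ, the constants in the three regimes are κ/log 2, log₂(1 + κ/c) and 1/log 2.
  refine ⟨hint, hae.mono fun ω hω => ?_, ?_, fun hlim => ?_, fun c hc hlim => ?_, fun hlim => ?_⟩
  · exact (isTheta_of_tendsto_div_one hd hω).trans (growth_isTheta hκ)
  · exact (isTheta_of_tendsto_div_one hd hmean).trans (growth_isTheta hκ)
  · exact .of_tendsto_div hd hae hmean (tendsto_natCast_atTop_atTop.comp hN_top) (by positivity)
      (tendsto_growth_div_of_atTop hκ hN_top hlim)
  · refine .of_tendsto_div hd hae hmean tendsto_id (Real.logb_pos one_lt_two ?_)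
      (tendsto_growth_div_of_nhds hκ hc hlim)
    have : 0 < L 0 / totalGain L / c := by positivity
    linarith
  · have hlog : Tendsto (fun l : ℝ => Real.log (1 + N l / l)) atTop atTop :=
      Real.tendsto_log_atTop.comp
        (tendsto_atTop_add_const_left _ _ (tendsto_ratio_atTop hN_top hlim))
    exact .of_tendsto_div hd hae hmean (tendsto_id.atTop_mul_atTop₀ hlog) (by positivity)
      (tendsto_growth_div_of_zero hκ hN_top hlim)
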